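/- Let $T_2, T_3, \dots$ be a sequence of random trees, where $T_2$ is the tree on two vertices and, for $n \ge 2$, given $T_2,\dots,T_n$, the tree $T_{n+1}$ is obtained from $T_n$ by adding one new vertex and joining it by an edge to a single vertex $u$ of $T_n$, chosen either uniformly at random (uniform attachment, UA) or with probability $\deg_{T_n}(u)/\sum_{w}\deg_{T_n}(w)$ (preferential attachment, PA). The timestamp $\tau(v)$ of a vertex $v$ is the least $n \ge 2$ such that $v$ belongs to $T_n$ (so both vertices of $T_2$ have timestamp $2$). For $v \in T_n$ the anti-centrality $\Psi_n(v)$ is the maximum, over the neighbours $u$ of $v$ in $T_n$, of the number of vertices $w$ of $T_n$ such that the path from $w$ to $v$ in $T_n$ contains $u$. Fix a vertex $v$ (that is, fix its position in the order of arrival, the two vertices of $T_2$ being numbered first; in particular $\tau(v)$ is fixed). Then the limit $$\Psi(v) := \lim_{n\to\infty} \frac{1}{n}\Psi_n(v)$$ exists almost surely. Moreover, let $\{\varphi_k\}_{k\ge 0}$ be mutually independent random variables with $$\varphi_0 \sim \begin{cases} \mathrm{Beta}(\tau(v)-1,\,1) & \text{for UA},\\ \mathrm{Beta}(\tau(v)-\tfrac32,\,\tfrac12)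 & \text{for PA},\end{cases} \qquad \varphi_k \sim \begin{cases} \mathrm{Beta}(1,1) & \text{for UA},\\ \mathrm{Beta}(\tfrac12,\,\tfrac{k+1}{2}) & \text{for PA},\end{cases} \quad (k \ge 1),$$ and let $\psi_\ell := \varphi_\ell\prod_{i=0}^{\ell-1}(1-\varphi_i)$ for $\ell\ge 0$ (so $\psi_0=\varphi_0$). Then the maximum $\max_{\ell\ge0}\psi_\ell$ is almost surely attained, and $$\Psi(v) \stackrel{d}{=} \max_{\ell\ge 0}\psi_\ell .$$ -/

import Mathlib

open MeasureTheory ProbabilityTheory Filter Topology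

namespace RandomTree

/-- The two attachment rules: uniform attachment and (linear) preferential attachment. -/
inductive AttachmentRule where
  | UA : AttachmentRule
  | PA : AttachmentRule

/-- The conditional probability, given the current graph `G` on `n` vertices, that the next
vertex attaches to `u`: it is `1 / n` for UA, and `deg u / ∑ w, deg w` for PA. -/
noncomputable def attachProb (R : AttachmentRule) {n : ℕ} (G : SimpleGraph (Fin n))
    (u : Fin n) : ℝ :=
  open Classical in
  match R with
  | .UA => 1 / (n : ℝ)
  | .PA => (G.degree u : ℝ) / ∑ w : Fin n, (G.degree w : ℝ)

/-- The graph on `n + 1` vertices obtained from `G` by adding the new vertex `n` (that is,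
`Fin.last n`) and a single edge joining it to `u`. -/
def attach {n : ℕ} (G : SimpleGraph (Fin n)) (u : Fin n) : SimpleGraph (Fin (n + 1)) :=
  G.map Fin.castSuccEmb ⊔ SimpleGraph.edge u.castSucc (Fin.last n)

/-- `T` is a sequence of random trees (`T n` has the `n` vertices `0, …, n - 1`, numbered in
order of arrival), defined for `n ≥ 2`, started from the two-vertex tree and grown according to
the attachment rule `R`. The values `T 0` and `T 1` play no role. -/
structure IsGrowingTree {Ω : Type*} [MeasurableSpace Ω] (R : AttachmentRule) (P : Measure Ω)
    (T : (n : ℕ) → Ω → SimpleGraph (Fin n)) : Prop where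
  measurable : ∀ n, 2 ≤ n → ∀ G : SimpleGraph (Fin n), MeasurableSet {ω | T n ω = G}
  /-- The seed is the unique tree on two vertices. -/
  seed : ∀ᵐ ω ∂P, T 2 ω = ⊤
  /-- Given the history up to time `n`, the new vertex chooses its neighbour according to `R`. -/
  growth : ∀ n, 2 ≤ n → ∀ (G : (k : ℕ) → SimpleGraph (Fin k)) (u : Fin n),
    P {ω | ∀ k, 2 ≤ k → k ≤ n → T k ω = G k} ≠ 0 →
    (ProbabilityTheory.cond P {ω | ∀ k, 2 ≤ k → k ≤ n → T k ω = G k}).real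
      {ω | T (n + 1) ω = attach (G n) u} = attachProb R (G n) u

/-- The vertex set of the subtree of the rooted tree `(G, v)` hanging from `u`: all `w` such that
the path from `w` to `v` contains `u`. -/
def pendentSubtree {V : Type*} (G : SimpleGraph V) (v u : V) : Set V :=
  {w | ∃ p : G.Walk w v, p.IsPath ∧ u ∈ p.support}

/-- The anti-centrality of `v`: the number of vertices of the largest subtree hanging from a
neighbour of `v`. -/
noncomputable def antiCentrality {V : Type*} [Fintype V] (G : SimpleGraph V) (v : V) : ℕ :=
  open Classical in
  (Finset.univ.filter fun u => G.Adj v u).sup fun u => (pendentSubtree G v u).ncard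

/-- The normalized anti-centrality `Ψ_n(v) / n` of vertex number `v` in a graph with vertices
`0, …, n - 1`; the value is irrelevant while `v` is not yet present. -/
noncomputable def normalizedAntiCentrality {n : ℕ} (G : SimpleGraph (Fin n)) (v : ℕ) : ℝ :=
  if h : v < n then (antiCentrality G ⟨v, h⟩ : ℝ) / n else 0

/-- The time at which vertex number `v` enters the tree: the least `k ≥ 2` such that `T k`
contains `v`, i.e. `v < k`. The two seed vertices `0`, `1` have timestamp `2`. -/
def timestamp (v : ℕ) : ℕ := max 2 (v + 1)

/-- The law of the `k`-th beta variable, for a vertex with timestamp `τ`. -/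
noncomputable def stickLaw (R : AttachmentRule) (τ : ℕ) (k : ℕ) : Measure ℝ :=
  match R, k with
  | .UA, 0 => betaMeasure ((τ : ℝ) - 1) 1
  | .PA, 0 => betaMeasure ((τ : ℝ) - 3 / 2) (1 / 2)
  | .UA, _ + 1 => betaMeasure 1 1
  | .PA, j + 1 => betaMeasure (1 / 2) ((((j + 1 : ℕ) : ℝ) + 1) / 2)

/-- Stick-breaking: `ψ_ℓ = φ_ℓ ∏_{i < ℓ} (1 - φ_i)`; in particular `ψ_0 = φ_0`. -/
noncomputable def stick {Ω : Type*} (φ : ℕ → Ω → ℝ) (l : ℕ) (ω : Ω) : ℝ :=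
  φ l ω * ∏ i ∈ Finset.range l, (1 - φ i ω)

end RandomTree

/-!
The branches of the tree at the fixed vertex `v`, numbered in the order in which they appear, form
a Chinese restaurant process. If the tree has `n` vertices and `v` has `d` branches of
sizes `s 0, …, s (d - 1)`, then the next vertex joins branch `i` with probability `(s i - α) / W`
and opens a new branch with probability `(θ + α d) / W`, where `W = n - 1 + θ`, with `(α, θ) = (0, 1)` for
uniform and `(α, θ) = (1 / 2, 0)` for preferential attachment: a branch of size `s` has degree
sum `2 s - 1` and `v` has degree `d` (`IsBranching.sum_attachProb_mul`). The anti-centrality of `v`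
is the size of the largest branch (`IsBranching.antiCentrality_eq`).

*Convergence.* The share `(s i - α) / W` of each branch is a martingale, so the largest share is
a bounded submartingale and converges almost surely (`IsGrowingTree.exists_tendsto_maxShare`).

*The law of the limit.* Consider the stick breaking with independent proportions `φ` whose laws,
in the above parameters, are `Beta (s⁰ k - α, θ + α (k + 1))`, where `s⁰ k` is the size of branch
`k` at its creation. If a vertex joined branch `i` with probability equal to the `i`-th piece, and
opened a new branch with probability equal to the rest of the stick, the likelihood of a history would be
a product of powers of `φ i` and `1 - φ i` (`likelihood`). As beta laws are conjugate to such
factors, the posterior expectation of any function `F` of the sticks, given the current branch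
sizes, is a ratio of two integrals whose denominator is explicit, and it is harmonic for the Chinese
restaurant process (`IsStickBreaking.posterior_harmonic`). At the arrival of `v` it is the
expectation of `F`. After many steps the posterior law concentrates: piece `i` has posterior mean
`(s i - α) / W` and variance at most `(s i - α) / W ^ 2`, and all pieces from number `d` on together
have mean `(θ + α d) / W`, whose expectation tends to `0`. Hence, for a Lipschitz function `f` of
the largest piece, the posterior expectation is close to `f` at the largest share
(`IsStickBreaking.abs_posterior_sub_le`). So the largest share converges in distribution to the
largest piece (`IsStickBreaking.tendsto_integral_maxShare`), which identifies the law of the almost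
sure limit.
-/

namespace RandomTree

/-! ### Attaching a leaf -/

section Attach

variable {n : ℕ} {G : SimpleGraph (Fin n)} {u : Fin n}

@[simp] lemma attach_adj_castSucc {a b : Fin n} :
    (attach G u).Adj a.castSucc b.castSucc ↔ G.Adj a b := by
  have ha := Fin.castSucc_ne_last a
  have hb := Fin.castSucc_ne_last b
  constructor
  · intro h
    rcases h with h | h
    · obtain ⟨x, y, hxy, hx, hy⟩ := h.2
      have hx' : x.castSucc = a.castSucc := hx
      have hy' : y.castSucc = b.castSucc := hy
      rw [Fin.castSucc_inj] at hx' hy'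
      exact hx' ▸ hy' ▸ hxy
    · rw [SimpleGraph.edge_adj] at h
      tauto
  · intro h
    exact Or.inl (SimpleGraph.map_adj_apply.2 h)

@[simp] lemma attach_adj_last {a : Fin n} :
    (attach G u).Adj a.castSucc (Fin.last n) ↔ a = u := by
  have ha := Fin.castSucc_ne_last a
  constructor
  · rintro (h | h)
    · obtain ⟨x, y, hxy, hx, hy⟩ := h.2
      exact absurd hy (Fin.castSucc_ne_last y)
    · rw [SimpleGraph.edge_adj] at h
      rcases h.1 with h | h
      · exact Fin.castSucc_inj.1 h.1
      · exact absurd h.1 ha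
  · rintro rfl
    exact Or.inr ((SimpleGraph.edge_adj ..).2 ⟨Or.inl ⟨rfl, rfl⟩, ha⟩)

@[simp] lemma attach_last_adj {a : Fin n} :
    (attach G u).Adj (Fin.last n) a.castSucc ↔ a = u := by
  rw [SimpleGraph.adj_comm, attach_adj_last]

lemma attach_injective : Function.Injective (attach G) := by
  intro u u' h
  have : (attach G u').Adj u.castSucc (Fin.last n) := h ▸ attach_adj_last.2 rfl
  exact attach_adj_last.1 this

open Classical in
lemma degree_eq_sum (G : SimpleGraph (Fin n)) (a : Fin n) :
    G.degree a = ∑ x, if G.Adj a x then 1 else 0 := by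
  rw [← SimpleGraph.card_neighborFinset_eq_degree, SimpleGraph.neighborFinset_eq_filter,
    Finset.card_filter]

open Classical in
lemma degree_attach_castSucc (a : Fin n) :
    (attach G u).degree a.castSucc = G.degree a + if a = u then 1 else 0 := by
  rw [degree_eq_sum, degree_eq_sum, Fin.sum_univ_castSucc]
  simp only [attach_adj_castSucc, attach_adj_last]

open Classical in
lemma degree_attach_last : (attach G u).degree (Fin.last n) = 1 := by
  rw [degree_eq_sum, Fin.sum_univ_castSucc]
  simp only [attach_last_adj, SimpleGraph.irrefl]
  simp

lemma preconnected_attach (h : G.Preconnected) : (attach G u).Preconnected := by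
  have h1 : ∀ a b : Fin n, (attach G u).Reachable a.castSucc b.castSucc := fun a b =>
    (h a b).map (⟨Fin.castSucc, fun h => attach_adj_castSucc.2 h⟩ : G →g attach G u)
  have h2 : (attach G u).Reachable u.castSucc (Fin.last n) :=
    (attach_adj_last.2 rfl : (attach G u).Adj _ _).reachable
  intro a b
  induction a using Fin.lastCases with
  | last =>
    induction b using Fin.lastCases with
    | last => exact SimpleGraph.Reachable.refl _
    | cast b => exact h2.symm.trans (h1 u b)
  | cast a =>
    induction b using Fin.lastCases with
    | last => exact (h1 a u).trans h2
    | cast b => exact h1 a b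

end Attach

/-! ### Branches at a vertex -/

/-- The size at which branch number `i` at a vertex of timestamp `τ` is created: branch `0` is
the whole tree found by the vertex on its arrival, all others start as a single vertex. -/
def seedSize (τ i : ℕ) : ℕ := if i = 0 then τ - 1 else 1

open Classical in
/-- The tree `G` has `d` branches at `v`, numbered `0, …, d - 1`: the branch of `w ≠ v` is
`c w` (the value `c v` is irrelevant), and branch `i` has grown by `t i` vertices since its
creation. The two degree conditions hold because the vertices of a branch of size `s` span `s - 1`
edges and send one edge to `v`. -/
structure IsBranching (τ : ℕ) {n : ℕ} (G : SimpleGraph (Fin n)) (v : Fin n) (d : ℕ)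
    (c : Fin n → ℕ) (t : ℕ → ℕ) : Prop where
  preconnected : G.Preconnected
  pos : 0 < d
  color_lt : ∀ w, w ≠ v → c w < d
  color_adj : ∀ w w', G.Adj w w' → w ≠ v → w' ≠ v → c w = c w'
  color_inj : ∀ u u', G.Adj v u → G.Adj v u' → c u = c u' → u = u'
  color_surj : ∀ i < d, ∃ u, G.Adj v u ∧ c u = i
  zero_of_le : ∀ i, d ≤ i → t i = 0
  card_color : ∀ i < d, (∑ w, if w ≠ v ∧ c w = i then 1 else 0) = t i + seedSize τ i
  degree_root : G.degree v = d
  degree_color : ∀ i < d,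
    (∑ w, if w ≠ v ∧ c w = i then G.degree w else 0) + 1 = 2 * (t i + seedSize τ i)

namespace IsBranching

variable {τ n : ℕ} {G : SimpleGraph (Fin n)} {v : Fin n} {d : ℕ} {c : Fin n → ℕ} {t : ℕ → ℕ}

open Classical in
/-- A new leaf attached to `v` itself opens a new branch. -/
lemma attach_root (h : IsBranching τ G v d c t) :
    IsBranching τ (attach G v) v.castSucc (d + 1) (Fin.snoc (α := fun _ => ℕ) c d) t := by
  have hlast : Fin.last n ≠ v.castSucc := (Fin.castSucc_ne_last v).symm
  have hd0 := h.pos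
  refine ⟨preconnected_attach h.preconnected, by omega, ?_, ?_, ?_, ?_, ?_, ?_, ?_, ?_⟩
  · intro w hw
    induction w using Fin.lastCases with
    | last => simp
    | cast w =>
      have := h.color_lt w (by simpa using hw)
      simp; omega
  · intro w w' hadj hw hw'
    induction w using Fin.lastCases with
    | last =>
      induction w' using Fin.lastCases with
      | last => rfl
      | cast w' => simp at hadj hw'; exact absurd hadj hw'
    | cast w =>
      induction w' using Fin.lastCases with
      | last => simp at hadj hw; exact absurd hadj hw
      | cast w' =>
        simp at hadj hw hw' ⊢
        exact h.color_adj w w' hadj hw hw'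
  · intro w w' hw hw'
    induction w using Fin.lastCases with
    | last =>
      induction w' using Fin.lastCases with
      | last => simp
      | cast w' =>
        simp at hw'
        have := h.color_lt w' hw'.ne'
        simp; omega
    | cast w =>
      induction w' using Fin.lastCases with
      | last =>
        simp at hw
        have := h.color_lt w hw.ne'
        simp; omega
      | cast w' =>
        simp at hw hw' ⊢
        exact h.color_inj w w' hw hw'
  · intro i hi
    rcases Nat.lt_succ_iff_lt_or_eq.1 hi with hi | rfl
    · obtain ⟨u, hu, hc⟩ := h.color_surj i hi
      exact ⟨u.castSucc, by simpa using hu, by simpa using hc⟩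
    · exact ⟨Fin.last n, by simp, by simp⟩
  · intro i hi
    exact h.zero_of_le i (by omega)
  · intro i hi
    rw [Fin.sum_univ_castSucc]
    simp only [ne_eq, Fin.castSucc_inj, Fin.snoc_castSucc, Fin.snoc_last, hlast, not_false_eq_true,
      true_and]
    rcases Nat.lt_succ_iff_lt_or_eq.1 hi with hi | rfl
    · rw [if_neg (by omega)]
      exact h.card_color i hi
    · rw [if_pos rfl, Finset.sum_eq_zero, h.zero_of_le _ le_rfl, seedSize, if_neg h.pos.ne']
      intro w _
      rw [if_neg]
      rintro ⟨hw, hc⟩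
      exact (h.color_lt w hw).ne hc
  · rw [degree_attach_castSucc, if_pos rfl, h.degree_root]
  · intro i hi
    rw [Fin.sum_univ_castSucc]
    simp only [ne_eq, Fin.castSucc_inj, Fin.snoc_castSucc, Fin.snoc_last, hlast, not_false_eq_true,
      true_and, degree_attach_castSucc, degree_attach_last]
    have key : ∀ w : Fin n, (if ¬ w = v ∧ c w = i then G.degree w + (if w = v then 1 else 0) else 0)
        = if w ≠ v ∧ c w = i then G.degree w else 0 := by
      intro w
      by_cases hw : w = v <;> simp [hw]
    rw [Finset.sum_congr rfl fun w _ => key w]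
    rcases Nat.lt_succ_iff_lt_or_eq.1 hi with hi | rfl
    · rw [if_neg (by omega)]
      exact h.degree_color i hi
    · rw [if_pos rfl, Finset.sum_eq_zero, h.zero_of_le _ le_rfl, seedSize, if_neg h.pos.ne']
      intro w _
      rw [if_neg]
      rintro ⟨hw, hc⟩
      exact (h.color_lt w hw).ne hc

open Classical in
/-- A new leaf attached to a vertex of some branch enlarges that branch. -/
lemma attach_of_ne (h : IsBranching τ G v d c t) {u : Fin n} (hu : u ≠ v) :
    IsBranching τ (attach G u) v.castSucc d (Fin.snoc (α := fun _ => ℕ) c (c u))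
      (t + Pi.single (c u) 1) := by
  have hlast : Fin.last n ≠ v.castSucc := (Fin.castSucc_ne_last v).symm
  have hcu := h.color_lt u hu
  refine ⟨preconnected_attach h.preconnected, h.pos, ?_, ?_, ?_, ?_, ?_, ?_, ?_, ?_⟩
  · intro w hw
    induction w using Fin.lastCases with
    | last => simpa
    | cast w => simpa using h.color_lt w (by simpa using hw)
  · intro w w' hadj hw hw'
    induction w using Fin.lastCases with
    | last =>
      induction w' using Fin.lastCases with
      | last => rfl
      | cast w' => simp at hadj; simp [hadj]
    | cast w =>
      induction w' using Fin.lastCases with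
      | last => simp at hadj; simp [hadj]
      | cast w' =>
        simp at hadj hw hw' ⊢
        exact h.color_adj w w' hadj hw hw'
  · intro w w' hw hw'
    induction w using Fin.lastCases with
    | last => simp at hw; exact absurd hw.symm hu
    | cast w =>
      induction w' using Fin.lastCases with
      | last => simp at hw'; exact absurd hw'.symm hu
      | cast w' =>
        simp at hw hw' ⊢
        exact h.color_inj w w' hw hw'
  · intro i hi
    obtain ⟨u, hu, hc⟩ := h.color_surj i hi
    exact ⟨u.castSucc, by simpa using hu, by simpa using hc⟩
  · intro i hi
    have : i ≠ c u := by omega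
    simp [h.zero_of_le i hi, this]
  · intro i hi
    rw [Fin.sum_univ_castSucc]
    simp only [ne_eq, Fin.castSucc_inj, Fin.snoc_castSucc, Fin.snoc_last, hlast, not_false_eq_true,
      true_and]
    have := h.card_color i hi
    simp only [ne_eq] at this
    rw [this]
    by_cases hc : c u = i
    · subst hc; simp; omega
    · simp [hc, Ne.symm hc]
  · rw [degree_attach_castSucc, if_neg hu.symm, h.degree_root, add_zero]
  · intro i hi
    rw [Fin.sum_univ_castSucc]
    simp only [ne_eq, Fin.castSucc_inj, Fin.snoc_castSucc, Fin.snoc_last, hlast, not_false_eq_true,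
      true_and, degree_attach_castSucc, degree_attach_last]
    have key : ∀ w : Fin n, (if ¬ w = v ∧ c w = i then G.degree w + (if w = u then 1 else 0) else 0)
        = (if w ≠ v ∧ c w = i then G.degree w else 0) +
          if w = u then (if c u = i then 1 else 0) else 0 := by
      intro w
      by_cases hw : w = u
      · subst hw; by_cases hc : c w = i <;> simp [hu, hc]
      · simp [hw]
    rw [Finset.sum_congr rfl fun w _ => key w, Finset.sum_add_distrib, Finset.sum_ite_eq']
    have := h.degree_color i hi
    simp only [ne_eq] at this
    simp only [ne_eq, Finset.mem_univ, if_true]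
    by_cases hc : c u = i
    · subst hc; simp; omega
    · simp [hc, Ne.symm hc]; omega

open Classical in
/-- When `v` is a leaf, there is just one branch. -/
lemma of_unique_neighbor {u : Fin n} (hG : G.Preconnected)
    (hdeg : ∑ w, G.degree w = 2 * (n - 1)) (hu : ∀ w, G.Adj v w ↔ w = u) :
    IsBranching n G v 1 (fun _ => 0) 0 := by
  have hv : G.degree v = 1 := by simp [degree_eq_sum, hu]
  refine ⟨hG, one_pos, fun _ _ => one_pos, fun _ _ _ _ _ => rfl, ?_, ?_, fun _ _ => rfl, ?_, hv, ?_⟩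
  · intro a b ha hb _
    rw [hu] at ha hb
    rw [ha, hb]
  · intro i hi
    exact ⟨u, (hu u).2 rfl, by omega⟩
  · intro i hi
    obtain rfl : i = 0 := by omega
    have : (∑ w : Fin n, if w = v then 1 else 0) + (∑ w : Fin n, if w ≠ v then 1 else 0) = n := by
      rw [← Finset.sum_add_distrib]
      calc _ = ∑ w : Fin n, 1 := Finset.sum_congr rfl fun w _ => by by_cases h : w = v <;> simp [h]
        _ = n := by simp
    rw [Finset.sum_ite_eq'] at this
    simp only [Finset.mem_univ, if_true] at this
    simp only [and_true, seedSize, if_true, Pi.zero_apply]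
    omega
  · intro i hi
    obtain rfl : i = 0 := by omega
    have : (∑ w : Fin n, if w = v then G.degree v else 0) +
        (∑ w : Fin n, if w ≠ v then G.degree w else 0) = 2 * (n - 1) := by
      rw [← hdeg, ← Finset.sum_add_distrib]
      exact Finset.sum_congr rfl fun w _ => by
        by_cases h : w = v
        · subst h; simp
        · simp [h]
    rw [Finset.sum_ite_eq'] at this
    simp only [Finset.mem_univ, if_true, hv] at this
    simp only [and_true, seedSize, if_true, Pi.zero_apply]
    omega

/-- Splitting a sum over the vertices according to the branches. -/
lemma sum_eq (h : IsBranching τ G v d c t) {M : Type*} [AddCommMonoid M] (f : Fin n → M) :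
    ∑ w, f w = f v + ∑ i ∈ Finset.range d, ∑ w, if w ≠ v ∧ c w = i then f w else 0 := by
  rw [Finset.sum_comm, ← Finset.add_sum_erase _ _ (Finset.mem_univ v),
    ← Finset.add_sum_erase (a := v) (f := fun w => ∑ i ∈ Finset.range d, _) _
      (Finset.mem_univ v)]
  simp only [ne_eq, not_true_eq_false, false_and, if_false, Finset.sum_const_zero, zero_add]
  congr 1
  refine Finset.sum_congr rfl fun w hw => ?_
  have hw' := Finset.ne_of_mem_erase hw
  simp [hw', h.color_lt w hw']

lemma sum_size (h : IsBranching τ G v d c t) :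
    n = 1 + ∑ i ∈ Finset.range d, (t i + seedSize τ i) := by
  have := h.sum_eq (fun _ => 1)
  simp only [Finset.sum_const, Finset.card_univ, Fintype.card_fin, smul_eq_mul, mul_one] at this
  rw [this]
  congr 1
  exact Finset.sum_congr rfl fun i hi => h.card_color i (Finset.mem_range.1 hi)

open Classical in
lemma sum_degree (h : IsBranching τ G v d c t) : ∑ w, G.degree w = 2 * (n - 1) := by
  have h1 := h.sum_eq (fun w => G.degree w)
  have h2 := h.sum_size
  have h3 : ∑ i ∈ Finset.range d, ((∑ w, if w ≠ v ∧ c w = i then G.degree w else 0) + 1) =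
      ∑ i ∈ Finset.range d, 2 * (t i + seedSize τ i) :=
    Finset.sum_congr rfl fun i hi => h.degree_color i (Finset.mem_range.1 hi)
  rw [Finset.sum_add_distrib, ← Finset.mul_sum] at h3
  simp only [Finset.sum_const, Finset.card_range, smul_eq_mul, mul_one] at h3
  rw [h1, h.degree_root]
  omega

lemma size_pos (h : IsBranching τ G v d c t) {i : ℕ} (hi : i < d) : 0 < t i + seedSize τ i := by
  have := h.degree_color i hi
  omega

/-- The vertices of a path that ends at `v`, other than `v` itself, all lie in one branch. -/
lemma color_eq_of_mem_support (h : IsBranching τ G v d c t) {w : Fin n} (p : G.Walk w v)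
    (hp : p.IsPath) {x : Fin n} (hx : x ∈ p.support) (hxv : x ≠ v) : c w = c x := by
  induction p with
  | nil => simp at hx; exact absurd hx hxv
  | @cons a b e hadj q ih =>
    rw [SimpleGraph.Walk.cons_isPath_iff] at hp
    rw [SimpleGraph.Walk.support_cons, List.mem_cons] at hx
    rcases hx with rfl | hx
    · rfl
    · have ha : a ≠ e := fun he => hp.2 (he ▸ q.end_mem_support)
      have hb : b ≠ e := by
        rintro rfl
        have := SimpleGraph.Walk.eq_nil_iff_nil.2 (SimpleGraph.Walk.isPath_iff_nil.1 hp.1)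
        subst this
        simp at hx
        exact hxv hx
      exact (h.color_adj a b hadj ha hb).trans (ih h hp.1 hx hxv)

lemma pendentSubtree_eq (h : IsBranching τ G v d c t) {u : Fin n} (hu : G.Adj v u) :
    pendentSubtree G v u = {w | w ≠ v ∧ c w = c u} := by
  ext w
  constructor
  · rintro ⟨p, hp, hup⟩
    refine ⟨?_, h.color_eq_of_mem_support p hp hup hu.ne'⟩
    rintro rfl
    have := SimpleGraph.Walk.eq_nil_iff_nil.2 (SimpleGraph.Walk.isPath_iff_nil.1 hp)
    subst this
    simp at hup
    exact hu.ne' hup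
  · rintro ⟨hw, hc⟩
    obtain ⟨p, hp⟩ := (h.preconnected w v).exists_isPath
    refine ⟨p, hp, ?_⟩
    have hnil : ¬ p.Nil := SimpleGraph.Walk.not_nil_of_ne hw
    have hadj := p.adj_penultimate hnil
    have hmem : p.penultimate ∈ p.support := p.getVert_mem_support _
    have := h.color_eq_of_mem_support p hp hmem hadj.ne
    rw [h.color_inj u p.penultimate hu hadj.symm (hc.symm.trans this)]
    exact hmem

lemma antiCentrality_eq (h : IsBranching τ G v d c t) :
    antiCentrality G v = (Finset.range d).sup fun i => t i + seedSize τ i := by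
  classical
  have key : ∀ u, G.Adj v u → (pendentSubtree G v u).ncard = t (c u) + seedSize τ (c u) := by
    intro u hu
    rw [h.pendentSubtree_eq hu, ← h.card_color _ (h.color_lt u hu.ne'), ← Finset.card_filter,
      ← Set.ncard_coe_finset]
    simp
  unfold antiCentrality
  apply le_antisymm
  · refine Finset.sup_le fun u hu => ?_
    have hu : G.Adj v u := by simpa using hu
    rw [key u hu]
    exact Finset.le_sup (f := fun i => t i + seedSize τ i)
      (Finset.mem_range.2 (h.color_lt u hu.ne'))
  · refine Finset.sup_le fun i hi => ?_
    obtain ⟨u, hu, rfl⟩ := h.color_surj i (Finset.mem_range.1 hi)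
    rw [← key u hu]
    exact Finset.le_sup (f := fun u => (pendentSubtree G v u).ncard) (by simpa using hu)

end IsBranching

/-! ### Attachment probabilities of the branches -/

/-- The discount parameter of the Chinese restaurant process formed by the branches at a vertex. -/
noncomputable def discount : AttachmentRule → ℝ
  | .UA => 0
  | .PA => 1 / 2

/-- The concentration parameter of the Chinese restaurant process formed by the branches at a
vertex. -/
noncomputable def concentration : AttachmentRule → ℝ
  | .UA => 1
  | .PA => 0

lemma discount_nonneg (R : AttachmentRule) : 0 ≤ discount R := by cases R <;> norm_num [discount]

lemma discount_le (R : AttachmentRule) : discount R ≤ 1 / 2 := by cases R <;> norm_num [discount]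

lemma concentration_nonneg (R : AttachmentRule) : 0 ≤ concentration R := by
  cases R <;> norm_num [concentration]

lemma concentration_add_discount_pos (R : AttachmentRule) {x : ℝ} (hx : 0 < x) :
    0 < concentration R + discount R * x := by
  cases R <;> norm_num [concentration, discount, hx]

/-- The total weight `n - 1 + θ` of a tree on `n` vertices. -/
noncomputable def totalWeight (R : AttachmentRule) (n : ℕ) : ℝ := n - 1 + concentration R

lemma totalWeight_succ (R : AttachmentRule) (n : ℕ) :
    totalWeight R (n + 1) = totalWeight R n + 1 := by
  simp only [totalWeight]; push_cast; ring

lemma one_le_totalWeight (R : AttachmentRule) {n : ℕ} (hn : 2 ≤ n) : 1 ≤ totalWeight R n := by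
  have h : (2 : ℝ) ≤ n := by exact_mod_cast hn
  have := concentration_nonneg R
  simp only [totalWeight]; linarith

lemma attachProb_nonneg (R : AttachmentRule) {n : ℕ} (G : SimpleGraph (Fin n)) (u : Fin n) :
    0 ≤ attachProb R G u := by
  cases R <;> simp only [attachProb] <;> positivity

open Classical in
/-- A connected graph with the number of edges of a tree. -/
structure IsGrown {n : ℕ} (G : SimpleGraph (Fin n)) : Prop where
  preconnected : G.Preconnected
  sum_degree : ∑ w, G.degree w = 2 * (n - 1)

open Classical in
lemma IsGrown.attach {n : ℕ} {G : SimpleGraph (Fin n)} (h : IsGrown G) (u : Fin n) :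
    IsGrown (attach G u) := by
  refine ⟨preconnected_attach h.preconnected, ?_⟩
  rw [Fin.sum_univ_castSucc]
  simp only [degree_attach_castSucc, degree_attach_last, Finset.sum_add_distrib, h.sum_degree]
  have := u.pos
  simp
  omega

open Classical in
lemma isGrown_top : IsGrown (⊤ : SimpleGraph (Fin 2)) := by
  refine ⟨SimpleGraph.preconnected_top, ?_⟩
  simp only [degree_eq_sum, Fin.sum_univ_two, SimpleGraph.top_adj]
  simp

lemma IsGrown.sum_attachProb {n : ℕ} {G : SimpleGraph (Fin n)} (h : IsGrown G) (hn : 2 ≤ n)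
    (R : AttachmentRule) : ∑ u, attachProb R G u = 1 := by
  have hn' : (n : ℝ) ≠ 0 := by positivity
  cases R
  · simp [attachProb, hn']
  · simp only [attachProb]
    rw [← Finset.sum_div, div_self]
    rw [← Nat.cast_sum, h.sum_degree]
    have : 2 * (n - 1) ≠ 0 := by omega
    exact_mod_cast this

namespace IsBranching

variable {τ n : ℕ} {G : SimpleGraph (Fin n)} {v : Fin n} {d : ℕ} {c : Fin n → ℕ} {t : ℕ → ℕ}

lemma isGrown (h : IsBranching τ G v d c t) : IsGrown G := ⟨h.preconnected, h.sum_degree⟩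

lemma two_le (h : IsBranching τ G v d c t) : 2 ≤ n := by
  have h1 := h.sum_size
  have h2 : t 0 + seedSize τ 0 ≤ ∑ i ∈ Finset.range d, (t i + seedSize τ i) :=
    Finset.single_le_sum (f := fun i => t i + seedSize τ i) (fun _ _ => Nat.zero_le _)
      (Finset.mem_range.2 h.pos)
  have h3 := h.size_pos h.pos
  omega

lemma sum_degree_cast (h : IsBranching τ G v d c t) :
    open Classical in ∑ w, (G.degree w : ℝ) = 2 * (n - 1) := by
  rw [← Nat.cast_sum, h.sum_degree]
  have := h.two_le
  push_cast [Nat.cast_sub (show 1 ≤ n by omega)]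
  ring

lemma attachProb_root (h : IsBranching τ G v d c t) (R : AttachmentRule) :
    attachProb R G v = (concentration R + discount R * d) / totalWeight R n := by
  cases R
  · simp [attachProb, concentration, discount, totalWeight]
  · simp only [attachProb, concentration, discount, totalWeight]
    rw [h.sum_degree_cast, h.degree_root, mul_comm 2, ← div_div]
    ring

lemma attachProb_color (h : IsBranching τ G v d c t) (R : AttachmentRule) {i : ℕ} (hi : i < d) :
    (∑ w, if w ≠ v ∧ c w = i then attachProb R G w else 0) =
      ((t i + seedSize τ i : ℕ) - discount R) / totalWeight R n := by
  classical
  cases R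
  · simp only [attachProb, concentration, discount, totalWeight]
    rw [← h.card_color i hi]
    push_cast
    rw [sub_zero, sub_add_cancel, Finset.sum_div]
    exact Finset.sum_congr rfl fun w _ => by split_ifs <;> simp
  · simp only [attachProb, concentration, discount, totalWeight]
    rw [h.sum_degree_cast]
    have h1 : (∑ w, if w ≠ v ∧ c w = i then (G.degree w : ℝ) else 0) + 1 =
        2 * ((t i + seedSize τ i : ℕ) : ℝ) := by
      have := h.degree_color i hi
      exact_mod_cast this
    have h2 : (∑ w, if w ≠ v ∧ c w = i then (G.degree w : ℝ) / (2 * (n - 1)) else 0) =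
        (∑ w, if w ≠ v ∧ c w = i then (G.degree w : ℝ) else 0) / (2 * (n - 1)) := by
      rw [Finset.sum_div]
      exact Finset.sum_congr rfl fun w _ => by split_ifs <;> simp
    rw [h2, eq_sub_of_add_eq h1, add_zero, mul_comm 2 ((n : ℝ) - 1), ← div_div]
    ring

/-- The expected value of a function of the branch that the next vertex joins. -/
lemma sum_attachProb_mul (h : IsBranching τ G v d c t) (R : AttachmentRule) (g : Fin n → ℝ)
    (f : ℕ → ℝ) (hf : ∀ u, u ≠ v → g u = f (c u)) :
    ∑ u, attachProb R G u * g u =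
      (concentration R + discount R * d) / totalWeight R n * g v +
      ∑ i ∈ Finset.range d, ((t i + seedSize τ i : ℕ) - discount R) / totalWeight R n * f i := by
  rw [h.sum_eq, h.attachProb_root]
  congr 1
  refine Finset.sum_congr rfl fun i hi => ?_
  rw [← h.attachProb_color R (Finset.mem_range.1 hi), Finset.sum_mul]
  refine Finset.sum_congr rfl fun w _ => ?_
  split_ifs with hw
  · rw [hf w hw.1, hw.2]
  · simp

end IsBranching

/-- The discounted share of the largest branch at vertex number `v` in the total weight,
`(Ψ_n(v) - α) / (n - 1 + θ)`. -/
noncomputable def maxShare (R : AttachmentRule) (v : ℕ) (n : ℕ) (G : SimpleGraph (Fin n)) : ℝ :=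
  (n * normalizedAntiCentrality G v - discount R) / totalWeight R n

lemma maxShare_eq (R : AttachmentRule) {n : ℕ} (G : SimpleGraph (Fin n)) (v : Fin n) :
    maxShare R v n G = (antiCentrality G v - discount R) / totalWeight R n := by
  have : (n : ℝ) ≠ 0 := by have := v.pos; positivity
  simp [maxShare, normalizedAntiCentrality, mul_div_cancel₀ _ this]

lemma two_le_timestamp (v : ℕ) : 2 ≤ timestamp v := le_max_left _ _

lemma lt_of_timestamp_le {v n : ℕ} (hn : timestamp v ≤ n) : v < n :=
  lt_of_lt_of_le (Nat.lt_succ_self v) ((le_max_right _ _).trans hn)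

lemma antiCentrality_le {n : ℕ} (G : SimpleGraph (Fin n)) (v : Fin n) : antiCentrality G v ≤ n := by
  classical
  refine Finset.sup_le fun u _ => ?_
  simpa using Set.ncard_le_card (pendentSubtree G v u)

lemma abs_maxShare_le (R : AttachmentRule) {n : ℕ} (G : SimpleGraph (Fin n)) (v : Fin n)
    (hn : 2 ≤ n) : |maxShare R v n G| ≤ 2 := by
  have h1 := one_le_totalWeight R hn
  have h2 : (antiCentrality G v : ℝ) ≤ n := by exact_mod_cast antiCentrality_le G v
  have h3 : (0 : ℝ) ≤ antiCentrality G v := by positivity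
  have h4 : (2 : ℝ) ≤ n := by exact_mod_cast hn
  have := discount_nonneg R
  have := discount_le R
  have := concentration_nonneg R
  rw [maxShare_eq, abs_div, abs_of_pos (by linarith : 0 < totalWeight R n),
    div_le_iff₀ (by linarith), abs_le]
  unfold totalWeight at *
  constructor <;> linarith

/-- The discount and the total weight do not matter in the limit. -/
lemma tendsto_normalizedAntiCentrality {R : AttachmentRule} (v : ℕ)
    {T : (n : ℕ) → SimpleGraph (Fin n)} {x : ℝ}
    (h : Tendsto (fun n => maxShare R v n (T n)) atTop (𝓝 x)) :
    Tendsto (fun n => normalizedAntiCentrality (T n) v) atTop (𝓝 x) := by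
  have h0 : Tendsto (fun n : ℕ => ((n : ℝ))⁻¹) atTop (𝓝 0) := tendsto_inv_atTop_nhds_zero_nat
  have h1 : Tendsto (fun n : ℕ => maxShare R v n (T n) *
      (1 + (concentration R - 1) * (n : ℝ)⁻¹) + discount R * (n : ℝ)⁻¹) atTop (𝓝 x) := by
    simpa using (h.mul ((h0.const_mul (concentration R - 1)).const_add 1)).add
      (h0.const_mul (discount R))
  refine h1.congr' ?_
  filter_upwards [eventually_ge_atTop 2] with n hn
  have hW := one_le_totalWeight R hn
  have hn' : (n : ℝ) ≠ 0 := by positivity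
  have h2 : 1 + (concentration R - 1) * (n : ℝ)⁻¹ = totalWeight R n * (n : ℝ)⁻¹ := by
    unfold totalWeight; field_simp; ring
  rw [h2, maxShare]
  field_simp
  ring

/-- The share of the largest branch is a submartingale: already the share of the branch which is
largest now is a martingale. -/
lemma IsBranching.maxShare_le {τ n : ℕ} {G : SimpleGraph (Fin n)} {v : Fin n} {d : ℕ}
    {c : Fin n → ℕ} {t : ℕ → ℕ} (h : IsBranching τ G v d c t) (R : AttachmentRule) :
    maxShare R v n G ≤ ∑ u, attachProb R G u * maxShare R v (n + 1) (attach G u) := by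
  have hW := one_le_totalWeight R h.two_le
  have hW' : 0 < totalWeight R (n + 1) := by rw [totalWeight_succ]; linarith
  obtain ⟨j, hj, hsup⟩ := Finset.exists_mem_eq_sup (Finset.range d)
    ⟨0, Finset.mem_range.2 h.pos⟩ (fun i => t i + seedSize τ i)
  have hjd := Finset.mem_range.1 hj
  set s : ℝ := ((t j + seedSize τ j : ℕ) : ℝ) with hs
  have hcast : ∀ u, maxShare R v (n + 1) (RandomTree.attach G u) =
      (antiCentrality (RandomTree.attach G u) v.castSucc - discount R) / totalWeight R (n + 1) :=
    fun u => maxShare_eq R _ v.castSucc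
  have hlow : ∀ u, (s + (if u ≠ v ∧ c u = j then 1 else 0) - discount R) / totalWeight R (n + 1) ≤
      maxShare R v (n + 1) (RandomTree.attach G u) := by
    intro u
    rw [hcast]
    gcongr
    by_cases hu : u = v
    · subst hu
      rw [h.attach_root.antiCentrality_eq]
      have : t j + seedSize τ j ≤ _ := Finset.le_sup (s := Finset.range (d + 1))
        (f := fun i => t i + seedSize τ i) (Finset.mem_range.2 (Nat.lt_succ_of_lt hjd))
      simpa [hs] using (by exact_mod_cast this)
    · rw [(h.attach_of_ne hu).antiCentrality_eq]
      have := Finset.le_sup (s := Finset.range d)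
        (f := fun i => (t + Pi.single (c u) 1 : ℕ → ℕ) i + seedSize τ i) hj
      refine le_trans (le_of_eq ?_) (Nat.cast_le.2 this)
      by_cases hc : c u = j
      · subst hc
        simp [hs, hu]; ring
      · simp [hs, hu, hc, Ne.symm hc]
  rw [maxShare_eq, h.antiCentrality_eq, hsup]
  calc (s - discount R) / totalWeight R n
      = ∑ u, attachProb R G u *
        ((s + (if u ≠ v ∧ c u = j then 1 else 0) - discount R) / totalWeight R (n + 1)) := by
        have h1 : ∀ u, attachProb R G u *
            ((s + (if u ≠ v ∧ c u = j then 1 else 0) - discount R) / totalWeight R (n + 1)) =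
            attachProb R G u * ((s - discount R) / totalWeight R (n + 1)) +
            (if u ≠ v ∧ c u = j then attachProb R G u else 0) / totalWeight R (n + 1) := by
          intro u
          split_ifs <;> ring
        rw [Finset.sum_congr rfl fun u _ => h1 u, Finset.sum_add_distrib, ← Finset.sum_mul,
          ← Finset.sum_div, h.attachProb_color R hjd, h.isGrown.sum_attachProb h.two_le,
          totalWeight_succ, ← hs]
        field_simp
    _ ≤ _ := Finset.sum_le_sum fun u _ =>
        mul_le_mul_of_nonneg_left (hlow u) (attachProb_nonneg R G u)

/-- The expected value of `g` after `k` further steps of the growth, from the tree `G`. -/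
noncomputable def expectedValue (R : AttachmentRule) (g : ∀ n, SimpleGraph (Fin n) → ℝ) :
    ℕ → ∀ n, SimpleGraph (Fin n) → ℝ
  | 0, n, G => g n G
  | k + 1, n, G => ∑ u, attachProb R G u * expectedValue R g k (n + 1) (attach G u)

/-! ### The growing tree as a Markov chain -/

namespace IsGrowingTree

variable {Ω : Type*} [mΩ : MeasurableSpace Ω] {P : Measure Ω} {R : AttachmentRule}
  {T : (n : ℕ) → Ω → SimpleGraph (Fin n)}

/-- For `n < 2` there is only one graph on `Fin n`, so nothing has to be assumed there. -/
lemma measurableSet_eq (hT : IsGrowingTree R P T) (n : ℕ) (G : SimpleGraph (Fin n)) :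
    MeasurableSet {ω | T n ω = G} := by
  rcases lt_or_ge n 2 with hn | hn
  · have : Subsingleton (Fin n) := by
      interval_cases n <;> infer_instance
    have : {ω | T n ω = G} = Set.univ := by
      ext ω
      simp only [Set.mem_ofPred_eq, Set.mem_univ, iff_true]
      exact Subsingleton.elim _ _
    rw [this]
    exact MeasurableSet.univ
  · exact hT.measurable n hn G

lemma measurable_comp (hT : IsGrowingTree R P T) {n : ℕ} (g : SimpleGraph (Fin n) → ℝ) :
    Measurable fun ω => g (T n ω) := by
  intro s _
  have : (fun ω => g (T n ω)) ⁻¹' s = ⋃ G ∈ {G | g G ∈ s}, {ω | T n ω = G} := by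
    ext ω; simp
  rw [this]
  exact MeasurableSet.biUnion (Set.toFinite _).countable fun G _ => hT.measurableSet_eq n G

lemma integrable_comp (hT : IsGrowingTree R P T) [IsProbabilityMeasure P] {n : ℕ}
    (g : SimpleGraph (Fin n) → ℝ) : Integrable (fun ω => g (T n ω)) P := by
  obtain ⟨C, hC⟩ := (Set.finite_range fun G => ‖g G‖).bddAbove
  exact Integrable.of_bound (hT.measurable_comp g).aestronglyMeasurable C
    (ae_of_all _ fun ω => hC ⟨_, rfl⟩)

lemma setIntegral_comp (hT : IsGrowingTree R P T) [IsProbabilityMeasure P] {n : ℕ}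
    (g : SimpleGraph (Fin n) → ℝ) (A : Set Ω) :
    open Classical in
    ∫ ω in A, g (T n ω) ∂P = ∑ G, P.real (A ∩ {ω | T n ω = G}) * g G := by
  classical
  have h1 : ∀ ω, g (T n ω) = ∑ G, Set.indicator {ω | T n ω = G} (fun _ => g G) ω := by
    intro ω
    simp [Set.indicator_apply]
  simp_rw [h1]
  rw [integral_finsetSum]
  · refine Finset.sum_congr rfl fun G _ => ?_
    rw [integral_indicator (hT.measurableSet_eq n G), Measure.restrict_restrict
      (hT.measurableSet_eq n G), setIntegral_const, smul_eq_mul, Set.inter_comm]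
  · intro G _
    exact (integrable_const _).indicator (hT.measurableSet_eq n G)

/-- The history of the tree up to time `n`. -/
def history (T : (n : ℕ) → Ω → SimpleGraph (Fin n)) (n : ℕ) (ω : Ω) :
    (k : Fin (n + 1)) → SimpleGraph (Fin k) := fun k => T k ω

lemma measurableSet_history_preimage (hT : IsGrowingTree R P T) (n : ℕ)
    (B : Set ((k : Fin (n + 1)) → SimpleGraph (Fin k))) : MeasurableSet (history T n ⁻¹' B) := by
  have : history T n ⁻¹' B = ⋃ h ∈ B, ⋂ k : Fin (n + 1), {ω | T k ω = h k} := by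
    ext ω
    simp only [Set.mem_preimage, Set.mem_iUnion, Set.mem_iInter, Set.mem_ofPred_eq, exists_prop]
    constructor
    · intro h
      exact ⟨_, h, fun k => rfl⟩
    · rintro ⟨h, hB, hk⟩
      rwa [show history T n ω = h from funext hk]
  rw [this]
  exact MeasurableSet.biUnion (Set.toFinite _).countable fun h _ =>
    MeasurableSet.iInter fun k => hT.measurableSet_eq k (h k)

/-- The filtration generated by the growing tree. -/
def filtration (hT : IsGrowingTree R P T) : Filtration ℕ mΩ where
  seq n := MeasurableSpace.comap (history T n) ⊤
  mono' := by
    intro m n hmn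
    rintro _ ⟨B, _, rfl⟩
    exact ⟨{h | (fun k : Fin (m + 1) => h ⟨(k : ℕ), by omega⟩) ∈ B}, trivial, rfl⟩
  le' := by
    rintro n _ ⟨B, _, rfl⟩
    exact hT.measurableSet_history_preimage n B

/-- The one-step transition, integrated over the event that the history is `h`. -/
lemma setIntegral_fiber (hT : IsGrowingTree R P T) [IsProbabilityMeasure P] {n : ℕ} (hn : 2 ≤ n)
    (hgrown : ∀ᵐ ω ∂P, IsGrown (T n ω)) (g : SimpleGraph (Fin (n + 1)) → ℝ)
    (h : (k : Fin (n + 1)) → SimpleGraph (Fin k)) :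
    ∫ ω in history T n ⁻¹' {h}, g (T (n + 1) ω) ∂P =
      ∫ ω in history T n ⁻¹' {h}, ∑ u, attachProb R (T n ω) u * g (attach (T n ω) u) ∂P := by
  classical
  set A := history T n ⁻¹' {h} with hA
  have hAm : MeasurableSet A := hT.measurableSet_history_preimage n {h}
  by_cases hPA : P A = 0
  · rw [setIntegral_measure_zero _ hPA, setIntegral_measure_zero _ hPA]
  obtain ⟨ω₀, hω₀, hG⟩ : ∃ ω ∈ A, IsGrown (T n ω) := by
    by_contra! hcon
    exact hPA (measure_mono_null hcon hgrown)
  have hA' : A = {ω | ∀ k, 2 ≤ k → k ≤ n → T k ω = T k ω₀} := by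
    ext ω
    have hω₀' : history T n ω₀ = h := hω₀
    simp only [hA, Set.mem_preimage, Set.mem_singleton_iff, Set.mem_ofPred_eq, ← hω₀']
    constructor
    · intro he k _ hk
      exact congrFun he ⟨k, by omega⟩
    · intro he
      funext k
      rcases lt_or_ge (k : ℕ) 2 with hk | hk
      · have : Subsingleton (Fin k) := by
          generalize (k : ℕ) = m at hk
          interval_cases m <;> infer_instance
        exact Subsingleton.elim _ _
      · exact he k hk (by omega)
  set G := T n ω₀ with hGdef
  have hgr : ∀ u, P.real (A ∩ {ω | T (n + 1) ω = attach G u}) = P.real A * attachProb R G u := by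
    intro u
    have h1 := hT.growth n hn (fun k => T k ω₀) u (hA' ▸ hPA)
    rw [← hA', Measure.real, cond_apply hAm, ENNReal.toReal_mul, ENNReal.toReal_inv,
      ← Measure.real, ← Measure.real] at h1
    have hne : P.real A ≠ 0 := by
      rw [Measure.real, ENNReal.toReal_ne_zero]
      exact ⟨hPA, measure_ne_top _ _⟩
    rw [← h1, mul_inv_cancel_left₀ hne]
  have hconst : ∫ ω in A, ∑ u, attachProb R (T n ω) u * g (attach (T n ω) u) ∂P =
      P.real A * ∑ u, attachProb R G u * g (attach G u) := by
    rw [setIntegral_congr_fun (g := fun _ => ∑ u, attachProb R G u * g (attach G u)) hAm,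
      setIntegral_const, smul_eq_mul]
    intro ω hω
    rw [hA'] at hω
    have : T n ω = G := hω n hn le_rfl
    simp only [this]
  -- the graphs `attach G u` exhaust the probability of `A`, so no other graph can follow `G`
  have htot : ∑ G', P.real (A ∩ {ω | T (n + 1) ω = G'}) = P.real A := by
    have := hT.setIntegral_comp (n := n + 1) (fun _ => (1 : ℝ)) A
    simpa using this.symm
  have himg : ∑ G' ∈ Finset.univ.image (attach G), P.real (A ∩ {ω | T (n + 1) ω = G'}) =
      P.real A := by
    rw [Finset.sum_image fun a _ b _ hab => attach_injective hab,
      Finset.sum_congr rfl fun u _ => hgr u, ← Finset.mul_sum, hG.sum_attachProb hn, mul_one]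
  have hzero : ∀ G' ∉ Finset.univ.image (attach G),
      P.real (A ∩ {ω | T (n + 1) ω = G'}) = 0 := by
    have h0 : ∑ G' ∈ (Finset.univ.image (attach G))ᶜ,
        P.real (A ∩ {ω | T (n + 1) ω = G'}) = 0 := by
      have := Finset.sum_add_sum_compl (Finset.univ.image (attach G))
        (fun G' => P.real (A ∩ {ω | T (n + 1) ω = G'}))
      linarith
    intro G' hG'
    exact (Finset.sum_eq_zero_iff_of_nonneg fun _ _ => measureReal_nonneg).1 h0 G'
      (Finset.mem_compl.2 hG')
  rw [hconst, hT.setIntegral_comp g A,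
    ← Finset.sum_subset (Finset.subset_univ (Finset.univ.image (attach G)))
      fun G' _ hG' => by rw [hzero G' hG', zero_mul],
    Finset.sum_image fun a _ b _ hab => attach_injective hab, Finset.mul_sum]
  exact Finset.sum_congr rfl fun u _ => by rw [hgr u, mul_assoc]

/-- The one-step transition of the growing tree, integrated over an event of the past. -/
lemma setIntegral_step (hT : IsGrowingTree R P T) [IsProbabilityMeasure P] {n : ℕ} (hn : 2 ≤ n)
    (hgrown : ∀ᵐ ω ∂P, IsGrown (T n ω)) (g : SimpleGraph (Fin (n + 1)) → ℝ)
    (B : Set ((k : Fin (n + 1)) → SimpleGraph (Fin k))) :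
    ∫ ω in history T n ⁻¹' B, g (T (n + 1) ω) ∂P =
      ∫ ω in history T n ⁻¹' B, ∑ u, attachProb R (T n ω) u * g (attach (T n ω) u) ∂P := by
  classical
  have hB : history T n ⁻¹' B = ⋃ h ∈ B.toFinset, history T n ⁻¹' {h} := by
    ext ω; simp
  have hdisj : Set.Pairwise (B.toFinset : Set _) (Function.onFun Disjoint
      fun h => history T n ⁻¹' {h}) := fun a _ b _ hab =>
    (Set.disjoint_singleton.2 hab).preimage _
  rw [hB, integral_biUnion_finset _ (fun h _ => hT.measurableSet_history_preimage n {h}) hdisj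
      fun h _ => (hT.integrable_comp g).integrableOn,
    integral_biUnion_finset _ (fun h _ => hT.measurableSet_history_preimage n {h}) hdisj
      fun h _ => (hT.integrable_comp
        fun G => ∑ u, attachProb R G u * g (attach G u)).integrableOn]
  exact Finset.sum_congr rfl fun h _ => hT.setIntegral_fiber hn hgrown g h

lemma integral_step (hT : IsGrowingTree R P T) [IsProbabilityMeasure P] {n : ℕ} (hn : 2 ≤ n)
    (hgrown : ∀ᵐ ω ∂P, IsGrown (T n ω)) (g : SimpleGraph (Fin (n + 1)) → ℝ) :
    ∫ ω, g (T (n + 1) ω) ∂P = ∫ ω, ∑ u, attachProb R (T n ω) u * g (attach (T n ω) u) ∂P := by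
  simpa using hT.setIntegral_step hn hgrown g Set.univ

/-- The tree at time `n + 1` arises from the tree at time `n` by attaching a leaf. -/
lemma ae_exists_attach (hT : IsGrowingTree R P T) [IsProbabilityMeasure P] {n : ℕ} (hn : 2 ≤ n)
    (hgrown : ∀ᵐ ω ∂P, IsGrown (T n ω)) :
    ∀ᵐ ω ∂P, ∃ u, T (n + 1) ω = attach (T n ω) u := by
  classical
  have key : ∀ G : SimpleGraph (Fin n),
      ∀ᵐ ω ∂P, T n ω = G → ∃ u, T (n + 1) ω = attach G u := by
    intro G
    let B : Set ((k : Fin (n + 1)) → SimpleGraph (Fin k)) := {h | h (Fin.last n) = G}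
    have hB : MeasurableSet (history T n ⁻¹' B) := hT.measurableSet_history_preimage n B
    -- the indicator of the graphs that do not arise from `G`
    let g : SimpleGraph (Fin (n + 1)) → ℝ := fun G' => if ∃ u, G' = attach G u then 0 else 1
    have h1 := hT.setIntegral_step hn hgrown g B
    have h2 : ∫ ω in history T n ⁻¹' B,
        ∑ u, attachProb R (T n ω) u * g (attach (T n ω) u) ∂P = 0 := by
      refine (setIntegral_congr_fun hB fun ω hω => ?_).trans (integral_zero _ _)
      have : T n ω = G := hω
      rw [this]
      refine Finset.sum_eq_zero fun u _ => ?_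
      simp [g]
    rw [h2, setIntegral_eq_zero_iff_of_nonneg_ae (ae_of_all _ fun ω => by
      simp only [g, Pi.zero_apply]; split_ifs <;> norm_num)
      (hT.integrable_comp g).integrableOn] at h1
    rw [Filter.EventuallyEq, ae_restrict_iff' hB] at h1
    filter_upwards [h1] with ω hω hG
    have := hω hG
    by_contra hcon
    simp [g, hcon] at this
  have key' := ae_all_iff.2 key
  filter_upwards [key'] with ω hω
  exact hω _ rfl

lemma ae_isGrown (hT : IsGrowingTree R P T) [IsProbabilityMeasure P] {n : ℕ} (hn : 2 ≤ n) :
    ∀ᵐ ω ∂P, IsGrown (T n ω) := by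
  induction n, hn using Nat.le_induction with
  | base =>
    filter_upwards [hT.seed] with ω hω
    rw [hω]
    exact isGrown_top
  | succ n hn ih =>
    filter_upwards [ih, hT.ae_exists_attach hn ih] with ω h1 h2
    obtain ⟨u, hu⟩ := h2
    rw [hu]
    exact h1.attach u

lemma integral_expectedValue (hT : IsGrowingTree R P T) [IsProbabilityMeasure P]
    (g : ∀ n, SimpleGraph (Fin n) → ℝ) (k : ℕ) {n m : ℕ} (hn : 2 ≤ n) (hm : m = n + k) :
    ∫ ω, expectedValue R g k n (T n ω) ∂P = ∫ ω, g m (T m ω) ∂P := by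
  induction k generalizing n with
  | zero => subst hm; rfl
  | succ k ih =>
    rw [← ih (n := n + 1) (by omega) (by omega), hT.integral_step hn (hT.ae_isGrown hn)]
    rfl

/-- On its arrival, a vertex has one branch, which consists of all other vertices. -/
lemma ae_isBranching_timestamp (hT : IsGrowingTree R P T) [IsProbabilityMeasure P] (v : ℕ) :
    ∀ᵐ ω ∂P, IsBranching (timestamp v) (T (timestamp v) ω)
      ⟨v, lt_of_timestamp_le le_rfl⟩ 1 (fun _ => 0) 0 := by
  have hn := two_le_timestamp v
  suffices h : ∀ᵐ ω ∂P, ∃ u, ∀ w, (T (timestamp v) ω).Adj ⟨v, lt_of_timestamp_le le_rfl⟩ w ↔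
      w = u by
    filter_upwards [h, hT.ae_isGrown hn] with ω ⟨u, hu⟩ hG
    exact IsBranching.of_unique_neighbor hG.preconnected hG.sum_degree hu
  rcases lt_or_ge v 2 with hv | hv
  · have h2 : timestamp v = 2 := max_eq_left (by omega)
    generalize_proofs hlt
    revert hlt
    rw [h2]
    intro hlt
    filter_upwards [hT.seed] with ω hω
    rw [hω]
    refine ⟨⟨1 - v, by omega⟩, fun w => ?_⟩
    simp only [SimpleGraph.top_adj, ne_eq, Fin.ext_iff]
    omega
  · have h2 : timestamp v = v + 1 := max_eq_right (by omega)
    generalize_proofs hlt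
    revert hlt
    rw [h2]
    intro hlt
    filter_upwards [hT.ae_exists_attach hv (hT.ae_isGrown hv)] with ω ⟨u, hu⟩
    rw [hu]
    refine ⟨u.castSucc, fun w => ?_⟩
    change (attach (T v ω) u).Adj (Fin.last v) w ↔ _
    induction w using Fin.lastCases with
    | last => simpa using u.castSucc_ne_last.symm
    | cast w => simp

lemma ae_exists_isBranching (hT : IsGrowingTree R P T) [IsProbabilityMeasure P] (v : ℕ) {n : ℕ}
    (hn : timestamp v ≤ n) :
    ∀ᵐ ω ∂P, ∃ d c t, IsBranching (timestamp v) (T n ω) ⟨v, lt_of_timestamp_le hn⟩ d c t := by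
  induction n, hn using Nat.le_induction with
  | base =>
    filter_upwards [hT.ae_isBranching_timestamp v] with ω hω
    exact ⟨_, _, _, hω⟩
  | succ n hn ih =>
    have hn2 := (two_le_timestamp v).trans hn
    filter_upwards [ih, hT.ae_exists_attach hn2 (hT.ae_isGrown hn2)] with ω ⟨d, c, t, h⟩ ⟨u, hu⟩
    rw [hu]
    by_cases huv : u = ⟨v, lt_of_timestamp_le hn⟩
    · subst huv
      exact ⟨_, _, _, h.attach_root⟩
    · exact ⟨_, _, _, h.attach_of_ne huv⟩

/-- The share of the largest branch converges almost surely, being a bounded submartingale. -/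
lemma exists_tendsto_maxShare (hT : IsGrowingTree R P T) [IsProbabilityMeasure P] (v : ℕ) :
    ∃ Ψ : Ω → ℝ, Measurable Ψ ∧
      ∀ᵐ ω ∂P, Tendsto (fun n => maxShare R v n (T n ω)) atTop (𝓝 (Ψ ω)) := by
  set τ := timestamp v with hτ
  have h2 : ∀ n, 2 ≤ n + τ := fun n => (two_le_timestamp v).trans (Nat.le_add_left _ _)
  -- time is shifted by `τ`, since the share means nothing before the arrival of `v`
  let ℱ : Filtration ℕ mΩ :=
    ⟨fun n => hT.filtration (n + τ), fun m n h => hT.filtration.mono (by omega),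
      fun n => hT.filtration.le _⟩
  let f : ℕ → Ω → ℝ := fun n ω => maxShare R v (n + τ) (T (n + τ) ω)
  have hf : Submartingale f ℱ P := by
    refine submartingale_of_setIntegral_le_succ ?_ (fun n => hT.integrable_comp _) ?_
    · intro n
      refine Measurable.stronglyMeasurable ?_
      intro s _
      exact ⟨{h | maxShare R v (n + τ) (h (Fin.last (n + τ))) ∈ s}, trivial, rfl⟩
    · rintro n _ ⟨B, _, rfl⟩
      have h1 := hT.setIntegral_step (h2 n) (hT.ae_isGrown (h2 n)) (maxShare R v (n + τ + 1)) B
      have h3 : n + 1 + τ = n + τ + 1 := by omega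
      simp only [f]
      rw [h3, h1]
      refine setIntegral_mono_ae (hT.integrable_comp _).integrableOn
        (hT.integrable_comp fun G => ∑ u, attachProb R G u *
          maxShare R v (n + τ + 1) (attach G u)).integrableOn ?_
      filter_upwards [hT.ae_exists_isBranching v (n := n + τ) (by omega)] with ω ⟨d, c, t, h⟩
      exact h.maxShare_le R
  have hbdd : ∀ n, eLpNorm (f n) 1 P ≤ (2 : NNReal) := by
    intro n
    refine (eLpNorm_le_of_ae_bound (C := 2) (ae_of_all _ fun ω => ?_)).trans (by simp)
    exact abs_maxShare_le R (T (n + τ) ω) ⟨v, lt_of_timestamp_le (by omega)⟩ (h2 n)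
  obtain ⟨Ψ, hΨ, hlim⟩ := measurable_limit_of_tendsto_metrizable_ae
    (fun n => (hT.measurable_comp (maxShare R v (n + τ))).aemeasurable)
    (hf.exists_ae_tendsto_of_bdd hbdd)
  refine ⟨Ψ, hΨ, ?_⟩
  filter_upwards [hlim] with ω hω
  exact (tendsto_add_atTop_iff_nat τ).1 hω

end IsGrowingTree

/-! ### Beta moments -/

lemma betaPDFReal_nonneg {a b : ℝ} (ha : 0 < a) (hb : 0 < b) (x : ℝ) : 0 ≤ betaPDFReal a b x := by
  by_cases hx : 0 < x ∧ x < 1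
  · exact (betaPDFReal_pos hx.1 hx.2 ha hb).le
  · simp [betaPDFReal, hx]

lemma integral_betaPDFReal {a b : ℝ} (ha : 0 < a) (hb : 0 < b) : ∫ x, betaPDFReal a b x = 1 := by
  rw [integral_eq_lintegral_of_nonneg_ae (ae_of_all _ (betaPDFReal_nonneg ha hb))
    (measurable_betaPDFReal a b).aestronglyMeasurable]
  have := lintegral_betaPDF_eq_one ha hb
  simp only [betaPDF] at this
  rw [this, ENNReal.toReal_one]

/-- The mixed moments of the beta distribution. -/
lemma integral_betaMeasure_pow {a b : ℝ} (ha : 0 < a) (hb : 0 < b) (p q : ℕ) :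
    ∫ x, x ^ p * (1 - x) ^ q ∂betaMeasure a b = beta (a + p) (b + q) / beta a b := by
  have hap : 0 < a + p := by positivity
  have hbq : 0 < b + q := by positivity
  have h1 := (beta_pos ha hb).ne'
  have h2 := (beta_pos hap hbq).ne'
  rw [betaMeasure, integral_withDensity_eq_integral_toReal_smul
    (by unfold betaPDF; fun_prop) (ae_of_all _ fun x => by simp [betaPDF])]
  have h3 : ∀ x, (betaPDF a b x).toReal • (x ^ p * (1 - x) ^ q) =
      beta (a + p) (b + q) / beta a b * betaPDFReal (a + p) (b + q) x := by
    intro x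
    rw [betaPDF, ENNReal.toReal_ofReal (betaPDFReal_nonneg ha hb x), smul_eq_mul]
    by_cases hx : 0 < x ∧ x < 1
    · simp only [betaPDFReal, hx, and_self, if_true]
      have hx' : 0 < 1 - x := by linarith [hx.2]
      rw [show a + p - 1 = (a - 1) + p by ring, show b + q - 1 = (b - 1) + q by ring,
        Real.rpow_add_natCast hx.1.ne', Real.rpow_add_natCast hx'.ne']
      field_simp
    · simp [betaPDFReal, hx]
  simp_rw [h3]
  rw [integral_const_mul, integral_betaPDFReal hap hbq, mul_one]

lemma beta_add_one_left {a b : ℝ} (ha : 0 < a) (hb : 0 < b) :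
    beta (a + 1) b = beta a b * (a / (a + b)) := by
  have h1 : (0 : ℝ) < a + b := by positivity
  have h2 := (Real.Gamma_pos_of_pos h1).ne'
  rw [beta, beta, Real.Gamma_add_one ha.ne', show a + 1 + b = a + b + 1 by ring,
    Real.Gamma_add_one h1.ne']
  field_simp

lemma beta_add_one_right {a b : ℝ} (ha : 0 < a) (hb : 0 < b) :
    beta a (b + 1) = beta a b * (b / (a + b)) := by
  have h1 : (0 : ℝ) < a + b := by positivity
  have h2 := (Real.Gamma_pos_of_pos h1).ne'
  rw [beta, beta, Real.Gamma_add_one hb.ne', ← add_assoc, Real.Gamma_add_one h1.ne']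
  field_simp

lemma ae_betaMeasure_mem_Icc (a b : ℝ) : ∀ᵐ x ∂betaMeasure a b, x ∈ Set.Icc (0 : ℝ) 1 := by
  rw [betaMeasure, ae_withDensity_iff (by unfold betaPDF; fun_prop)]
  refine ae_of_all _ fun x hx => ?_
  by_contra hcon
  rw [Set.mem_Icc, not_and_or, not_le, not_le] at hcon
  rcases hcon with h | h
  · exact hx (betaPDF_eq_zero_of_nonpos h.le)
  · exact hx (betaPDF_eq_zero_of_one_le h.le)

/-- The laws of the proportions, for both rules in terms of the discount and the concentration. -/
lemma stickLaw_eq (R : AttachmentRule) {τ : ℕ} (hτ : 2 ≤ τ) (k : ℕ) :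
    stickLaw R τ k =
      betaMeasure (seedSize τ k - discount R) (concentration R + discount R * (k + 1)) := by
  have h1 : ((τ - 1 : ℕ) : ℝ) = τ - 1 := by push_cast [Nat.cast_sub (show 1 ≤ τ by omega)]; rfl
  cases R <;> rcases k with _ | k <;>
    simp only [stickLaw, seedSize, discount, concentration, if_true, h1, Nat.succ_ne_zero, if_false]
  · congr 1 <;> ring
  · congr 1 <;> norm_num
  · congr 1
    · ring
    · push_cast; ring
  · congr 1
    · norm_num
    · push_cast; ring

lemma seedSize_pos {τ : ℕ} (hτ : 2 ≤ τ) (k : ℕ) : 1 ≤ seedSize τ k := by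
  unfold seedSize; split_ifs <;> omega

lemma seedSize_sub_discount_pos {τ : ℕ} (hτ : 2 ≤ τ) (R : AttachmentRule) (k : ℕ) :
    0 < (seedSize τ k : ℝ) - discount R := by
  have h1 : (1 : ℝ) ≤ seedSize τ k := by exact_mod_cast seedSize_pos hτ k
  have := discount_le R
  linarith

/-! ### Breaking a stick -/

/-- What remains of the unit stick after `l` breaks with proportions `x 0, …, x (l - 1)`. -/
def stickRest (x : ℕ → ℝ) (l : ℕ) : ℝ := ∏ i ∈ Finset.range l, (1 - x i)

/-- The piece broken off the unit stick at break number `l`. -/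
def stickPiece (x : ℕ → ℝ) (l : ℕ) : ℝ := x l * stickRest x l

section StickBreaking

variable {x : ℕ → ℝ}

lemma sum_stickPiece (x : ℕ → ℝ) (d : ℕ) :
    ∑ i ∈ Finset.range d, stickPiece x i + stickRest x d = 1 := by
  induction d with
  | zero => simp [stickRest]
  | succ d ih =>
    rw [← ih, Finset.sum_range_succ, stickRest, Finset.prod_range_succ]
    simp only [stickPiece, stickRest]
    ring

lemma stickRest_nonneg (hx : ∀ i, x i ∈ Set.Icc (0 : ℝ) 1) (l : ℕ) : 0 ≤ stickRest x l :=
  Finset.prod_nonneg fun i _ => sub_nonneg.2 (hx i).2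

lemma stickRest_antitone (hx : ∀ i, x i ∈ Set.Icc (0 : ℝ) 1) : Antitone (stickRest x) := by
  refine antitone_nat_of_succ_le fun l => ?_
  have h := stickRest_nonneg hx l
  rw [stickRest, Finset.prod_range_succ]
  exact mul_le_of_le_one_right h (by linarith [(hx l).1])

lemma stickRest_le_one (hx : ∀ i, x i ∈ Set.Icc (0 : ℝ) 1) (l : ℕ) : stickRest x l ≤ 1 := by
  simpa [stickRest] using stickRest_antitone hx (Nat.zero_le l)

lemma stickPiece_nonneg (hx : ∀ i, x i ∈ Set.Icc (0 : ℝ) 1) (l : ℕ) : 0 ≤ stickPiece x l :=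
  mul_nonneg (hx l).1 (stickRest_nonneg hx l)

lemma stickPiece_le_rest (hx : ∀ i, x i ∈ Set.Icc (0 : ℝ) 1) (l : ℕ) :
    stickPiece x l ≤ stickRest x l :=
  mul_le_of_le_one_left (stickRest_nonneg hx l) (hx l).2

lemma bddAbove_stickPiece (hx : ∀ i, x i ∈ Set.Icc (0 : ℝ) 1) :
    BddAbove (Set.range (stickPiece x)) := by
  refine ⟨1, ?_⟩
  rintro _ ⟨l, rfl⟩
  exact (stickPiece_le_rest hx l).trans (stickRest_le_one hx l)

/-- If the stick is used up, the pieces tend to `0`, so one of them is the largest. -/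
lemma isGreatest_iSup_stickPiece (hx : ∀ i, x i ∈ Set.Icc (0 : ℝ) 1)
    (h0 : Tendsto (stickRest x) atTop (𝓝 0)) :
    IsGreatest (Set.range (stickPiece x)) (⨆ l, stickPiece x l) := by
  refine ⟨?_, ?_⟩
  · by_cases hpos : ∃ k, 0 < stickPiece x k
    · obtain ⟨k, hk⟩ := hpos
      obtain ⟨m, hm⟩ := eventually_atTop.1 (h0.eventually (gt_mem_nhds hk))
      -- beyond `m` all pieces are smaller than piece `k`, so the maximum is taken before
      obtain ⟨j, -, hj⟩ := Finset.exists_max_image (Finset.range (m + k + 1)) (stickPiece x)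
        ⟨k, Finset.mem_range.2 (by omega)⟩
      refine ⟨j, (le_antisymm (ciSup_le fun l => ?_) (le_ciSup (bddAbove_stickPiece hx) j)).symm⟩
      rcases lt_or_ge l (m + k + 1) with hl | hl
      · exact hj l (Finset.mem_range.2 hl)
      · exact ((stickPiece_le_rest hx l).trans (hm l (by omega)).le).trans
          (hj k (Finset.mem_range.2 (by omega)))
    · push Not at hpos
      have : ∀ l, stickPiece x l = 0 := fun l => le_antisymm (hpos l) (stickPiece_nonneg hx l)
      exact ⟨0, by simp [this]⟩
  · rintro _ ⟨l, rfl⟩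
    exact le_ciSup (bddAbove_stickPiece hx) l

/-- If the first `d` pieces are close to `s 0, …, s (d - 1)`, then the largest piece is close to
the largest of these numbers. The squares make the bound easy to integrate. -/
lemma abs_iSup_stickPiece_sub_le (hx : ∀ i, x i ∈ Set.Icc (0 : ℝ) 1) {d : ℕ} {s : ℕ → ℝ} {M : ℝ}
    (hM0 : 0 ≤ M) (hM : ∀ i < d, s i ≤ M) (hMs : ∃ j < d, M = s j) {ε : ℝ} (hε : 0 < ε) :
    |(⨆ l, stickPiece x l) - M| ≤
      ε + (∑ i ∈ Finset.range d, (stickPiece x i - s i) ^ 2) / ε + stickRest x d := by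
  have hR := stickRest_nonneg hx d
  have hterm : ∀ i < d, |stickPiece x i - s i| ≤
      ε + (∑ i ∈ Finset.range d, (stickPiece x i - s i) ^ 2) / ε := by
    intro i hi
    set y := |stickPiece x i - s i| with hy
    have h1 : y ^ 2 ≤ ∑ i ∈ Finset.range d, (stickPiece x i - s i) ^ 2 := by
      rw [hy, sq_abs]
      exact Finset.single_le_sum (f := fun i => (stickPiece x i - s i) ^ 2)
        (fun _ _ => sq_nonneg _) (Finset.mem_range.2 hi)
    -- the inequality of the arithmetic and geometric means
    have h2 : y ≤ ε + y ^ 2 / ε := by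
      rw [← sub_nonneg]
      have : ε + y ^ 2 / ε - y = ((ε - y / 2) ^ 2 + 3 / 4 * y ^ 2) / ε := by field_simp; ring
      rw [this]; positivity
    have h3 : y ^ 2 / ε ≤ (∑ i ∈ Finset.range d, (stickPiece x i - s i) ^ 2) / ε := by gcongr
    linarith
  have hS : 0 ≤ ε + (∑ i ∈ Finset.range d, (stickPiece x i - s i) ^ 2) / ε := by positivity
  rw [abs_le]
  constructor
  · obtain ⟨j, hj, rfl⟩ := hMs
    have h1 := (abs_le.1 (hterm j hj)).1
    have h2 := le_ciSup (bddAbove_stickPiece hx) j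
    linarith
  · rw [sub_le_iff_le_add]
    refine ciSup_le fun l => ?_
    rcases lt_or_ge l d with hl | hl
    · have h1 := (abs_le.1 (hterm l hl)).2
      have h2 := hM l hl
      linarith
    · have h1 := (stickPiece_le_rest hx l).trans (stickRest_antitone hx hl)
      linarith

/-- The number of vertices that joined the branches `i + 1, …, d - 1`. -/
def laterCount (d : ℕ) (t : ℕ → ℕ) (i : ℕ) : ℕ := ∑ j ∈ Finset.Ico (i + 1) d, (t j + 1)

/-- The conditional probability, given the proportions `x` of the stick breaking, of a growth
history in which `d` branches have appeared and branch `i` has grown by `t i` vertices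
since it was created: each growth of branch `i` contributes its piece of the stick, and each new
branch the rest of the stick not taken by the earlier branches. -/
def likelihood (d : ℕ) (t : ℕ → ℕ) (x : ℕ → ℝ) : ℝ :=
  ∏ i ∈ Finset.range d, x i ^ t i * (1 - x i) ^ laterCount d t i

lemma laterCount_add_single {d i : ℕ} (hi : i < d) (t : ℕ → ℕ) (j : ℕ) :
    laterCount d (t + Pi.single i 1) j = laterCount d t j + if j < i then 1 else 0 := by
  simp only [laterCount, Pi.add_apply]
  have : ∀ k, t k + (Pi.single i 1 : ℕ → ℕ) k + 1 = (t k + 1) + if k = i then 1 else 0 := by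
    intro k
    rw [Pi.single_apply]; ring
  rw [Finset.sum_congr rfl fun k _ => this k, Finset.sum_add_distrib, Finset.sum_ite_eq']
  congr 1
  simp only [Finset.mem_Ico]
  split_ifs <;> omega

lemma laterCount_succ {d : ℕ} {t : ℕ → ℕ} (ht : t d = 0) {j : ℕ} (hj : j < d) :
    laterCount (d + 1) t j = laterCount d t j + 1 := by
  rw [laterCount, Finset.sum_Ico_succ_top (by omega), ht, laterCount]

lemma prod_range_ite {d i : ℕ} (hi : i < d) (g h : ℕ → ℝ) :
    ∏ j ∈ Finset.range d, (if j = i then g j else if j < i then h j else 1) =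
      g i * ∏ j ∈ Finset.range i, h j := by
  rw [← Finset.prod_subset (Finset.range_mono (show i + 1 ≤ d from hi)), Finset.prod_range_succ,
    if_pos rfl, mul_comm]
  · congr 1
    refine Finset.prod_congr rfl fun j hj => ?_
    have := Finset.mem_range.1 hj
    rw [if_neg this.ne, if_pos this]
  · intro j _ hj
    have : i < j := by simpa using hj
    rw [if_neg this.ne', if_neg (by omega)]

lemma likelihood_add_single {d i : ℕ} (hi : i < d) (t : ℕ → ℕ) (x : ℕ → ℝ) :
    likelihood d (t + Pi.single i 1) x = likelihood d t x * stickPiece x i := by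
  rw [stickPiece, stickRest, ← prod_range_ite hi x fun j => 1 - x j, likelihood, likelihood,
    ← Finset.prod_mul_distrib]
  refine Finset.prod_congr rfl fun j _ => ?_
  rw [laterCount_add_single hi, Pi.add_apply, Pi.single_apply]
  rcases lt_trichotomy j i with h | h | h
  · rw [if_neg h.ne, if_pos h, if_neg h.ne, if_pos h]; ring
  · subst h; simp; ring
  · rw [if_neg h.ne', if_neg (by omega), if_neg h.ne', if_neg (by omega)]; ring

lemma likelihood_succ {d : ℕ} {t : ℕ → ℕ} (ht : t d = 0) (x : ℕ → ℝ) :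
    likelihood (d + 1) t x = likelihood d t x * stickRest x d := by
  rw [likelihood, Finset.prod_range_succ, likelihood, stickRest, ← Finset.prod_mul_distrib, ht]
  simp only [laterCount, Finset.Ico_self, Finset.sum_empty, pow_zero, mul_one]
  refine Finset.prod_congr rfl fun j hj => ?_
  have := laterCount_succ ht (Finset.mem_range.1 hj)
  simp only [laterCount] at this
  rw [this]; ring

lemma likelihood_nonneg (hx : ∀ i, x i ∈ Set.Icc (0 : ℝ) 1) (d : ℕ) (t : ℕ → ℕ) :
    0 ≤ likelihood d t x :=
  Finset.prod_nonneg fun i _ => mul_nonneg (pow_nonneg (hx i).1 _)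
    (pow_nonneg (sub_nonneg.2 (hx i).2) _)

lemma likelihood_le_one (hx : ∀ i, x i ∈ Set.Icc (0 : ℝ) 1) (d : ℕ) (t : ℕ → ℕ) :
    likelihood d t x ≤ 1 :=
  Finset.prod_le_one (fun i _ => mul_nonneg (pow_nonneg (hx i).1 _)
    (pow_nonneg (sub_nonneg.2 (hx i).2) _)) fun i _ =>
    mul_le_one₀ (pow_le_one₀ (hx i).1 (hx i).2) (pow_nonneg (sub_nonneg.2 (hx i).2) _)
      (pow_le_one₀ (sub_nonneg.2 (hx i).2) (by linarith [(hx i).1]))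

end StickBreaking

/-! ### The posterior law of the sticks -/

/-- The total weight of the branches `j, …, d - 1` together with that of a new branch, after the
discounts of the branches before `j` have gone to the latter. -/
noncomputable def tailWeight (R : AttachmentRule) (τ d : ℕ) (t : ℕ → ℕ) (j : ℕ) : ℝ :=
  concentration R + discount R * j + ∑ k ∈ Finset.Ico j d, ((t k + seedSize τ k : ℕ) : ℝ)

section TailWeight

variable {R : AttachmentRule} {τ d : ℕ} {t : ℕ → ℕ}

lemma tailWeight_self : tailWeight R τ d t d = concentration R + discount R * d := by
  simp [tailWeight]

lemma tailWeight_succ_eq (j : ℕ) : tailWeight R τ d t (j + 1) =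
    concentration R + discount R * (j + 1) + laterCount d t j := by
  simp only [tailWeight, laterCount]
  push_cast
  congr 1
  refine Finset.sum_congr rfl fun k hk => ?_
  have : k ≠ 0 := by have := (Finset.mem_Ico.1 hk).1; omega
  simp [seedSize, this]

lemma tailWeight_eq_add {j : ℕ} (hj : j < d) : tailWeight R τ d t j =
    ((t j + seedSize τ j : ℕ) - discount R) + tailWeight R τ d t (j + 1) := by
  simp only [tailWeight]
  rw [Finset.sum_eq_sum_Ico_succ_bot hj]
  push_cast
  ring

lemma size_sub_discount_pos (hτ : 2 ≤ τ) (R : AttachmentRule) (t : ℕ → ℕ) (j : ℕ) :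
    0 < ((t j + seedSize τ j : ℕ) : ℝ) - discount R := by
  have := seedSize_sub_discount_pos hτ R j
  push_cast
  have : (0 : ℝ) ≤ t j := by positivity
  linarith

lemma tailWeight_succ_pos (j : ℕ) : 0 < tailWeight R τ d t (j + 1) := by
  rw [tailWeight_succ_eq]
  have := concentration_add_discount_pos R (x := j + 1) (by positivity)
  positivity

lemma tailWeight_pos (hτ : 2 ≤ τ) {j : ℕ} (hj : j < d) : 0 < tailWeight R τ d t j := by
  rw [tailWeight_eq_add hj]
  exact add_pos (size_sub_discount_pos hτ R t j) (tailWeight_succ_pos j)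

lemma prod_tailWeight_div (hτ : 2 ≤ τ) {i : ℕ} (hi : i ≤ d) (hd : 0 < d) :
    ∏ j ∈ Finset.range i, (tailWeight R τ d t (j + 1) / tailWeight R τ d t j) =
      tailWeight R τ d t i / tailWeight R τ d t 0 := by
  induction i with
  | zero => rw [Finset.prod_range_zero, div_self (tailWeight_pos hτ hd).ne']
  | succ i ih =>
    rw [Finset.prod_range_succ, ih (by omega)]
    have := (tailWeight_pos (R := R) (t := t) hτ (show i < d by omega)).ne'
    field_simp

lemma tailWeight_add_single {i : ℕ} (hi : i < d) :
    tailWeight R τ d (t + Pi.single i 1) 0 = tailWeight R τ d t 0 + 1 := by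
  have : ∀ k, (((t + Pi.single i 1 : ℕ → ℕ) k + seedSize τ k : ℕ) : ℝ) =
      ((t k + seedSize τ k : ℕ) : ℝ) + if k = i then 1 else 0 := by
    intro k
    rw [Pi.add_apply, Pi.single_apply]; push_cast; ring
  simp only [tailWeight, this]
  rw [Finset.sum_add_distrib, Finset.sum_ite_eq', if_pos (by simpa using hi), ← add_assoc]

end TailWeight

lemma IsBranching.tailWeight_zero {τ n : ℕ} {G : SimpleGraph (Fin n)} {v : Fin n} {d : ℕ}
    {c : Fin n → ℕ} {t : ℕ → ℕ} (h : IsBranching τ G v d c t) (R : AttachmentRule) :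
    tailWeight R τ d t 0 = totalWeight R n := by
  have h1 : (n : ℝ) = 1 + ∑ k ∈ Finset.range d, ((t k + seedSize τ k : ℕ) : ℝ) := by
    exact_mod_cast h.sum_size
  simp only [tailWeight, totalWeight]
  rw [h1, Nat.Ico_zero_eq_range]
  push_cast
  ring

/-- Independent proportions with the laws of the stick breaking, normalized to be measurable and to
take values in `[0, 1]` everywhere. -/
structure IsStickBreaking {Ω : Type*} [MeasurableSpace Ω] (R : AttachmentRule) (τ : ℕ)
    (Q : Measure Ω) (φ : ℕ → Ω → ℝ) : Prop where
  two_le : 2 ≤ τ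
  measurable : ∀ k, Measurable (φ k)
  mem : ∀ ω k, φ k ω ∈ Set.Icc (0 : ℝ) 1
  indep : iIndepFun φ Q
  map_eq : ∀ k, Q.map (φ k) = stickLaw R τ k

namespace IsStickBreaking

variable {Ω : Type*} [MeasurableSpace Ω] {R : AttachmentRule} {τ : ℕ} {Q : Measure Ω}
  {φ : ℕ → Ω → ℝ}

lemma isProbabilityMeasure (h : IsStickBreaking R τ Q φ) : IsProbabilityMeasure Q :=
  h.indep.isProbabilityMeasure

lemma measurable_stickRest (h : IsStickBreaking R τ Q φ) (l : ℕ) :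
    Measurable fun ω => stickRest (φ · ω) l :=
  Finset.measurable_fun_prod _ fun i _ => (h.measurable i).const_sub 1

lemma measurable_stickPiece (h : IsStickBreaking R τ Q φ) (l : ℕ) :
    Measurable fun ω => stickPiece (φ · ω) l :=
  (h.measurable l).mul (h.measurable_stickRest l)

lemma measurable_iSup_stickPiece (h : IsStickBreaking R τ Q φ) :
    Measurable fun ω => ⨆ l, stickPiece (φ · ω) l :=
  Measurable.iSup h.measurable_stickPiece

lemma measurable_likelihood (h : IsStickBreaking R τ Q φ) (d : ℕ) (t : ℕ → ℕ) :
    Measurable fun ω => likelihood d t (φ · ω) :=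
  Finset.measurable_fun_prod _ fun i _ =>
    ((h.measurable i).pow_const _).mul (((h.measurable i).const_sub 1).pow_const _)

lemma integral_pow (h : IsStickBreaking R τ Q φ) (k p q : ℕ) :
    ∫ ω, φ k ω ^ p * (1 - φ k ω) ^ q ∂Q =
      beta (seedSize τ k - discount R + p) (concentration R + discount R * (k + 1) + q) /
        beta (seedSize τ k - discount R) (concentration R + discount R * (k + 1)) := by
  rw [← integral_betaMeasure_pow (seedSize_sub_discount_pos h.two_le R k)
    (concentration_add_discount_pos R (by positivity)), ← stickLaw_eq R h.two_le, ← h.map_eq,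
    integral_map (h.measurable k).aemeasurable (by fun_prop)]

lemma integral_prod (h : IsStickBreaking R τ Q φ) (d : ℕ) (f : ℕ → ℝ → ℝ)
    (hf : ∀ i, Measurable (f i)) :
    ∫ ω, ∏ i ∈ Finset.range d, f i (φ i ω) ∂Q =
      ∏ i ∈ Finset.range d, ∫ ω, f i (φ i ω) ∂Q := by
  have := (h.indep.precomp (Fin.val_injective (n := d))).integral_fun_prod_comp
    (f := fun i : Fin d => f i) (fun i => (h.measurable i).aemeasurable)
    (fun i => (hf i).aestronglyMeasurable)
  simp only [Finset.prod_range]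
  exact this

/-- The normalizing constant of the posterior law. -/
noncomputable def evidence (R : AttachmentRule) (τ d : ℕ) (t : ℕ → ℕ) : ℝ :=
  ∏ i ∈ Finset.range d,
    (beta (seedSize τ i - discount R + t i)
      (concentration R + discount R * (i + 1) + laterCount d t i) /
        beta (seedSize τ i - discount R) (concentration R + discount R * (i + 1)))

lemma integral_likelihood (h : IsStickBreaking R τ Q φ) (d : ℕ) (t : ℕ → ℕ) :
    ∫ ω, likelihood d t (φ · ω) ∂Q = evidence R τ d t := by
  simp only [likelihood]
  rw [h.integral_prod d (fun i x => x ^ t i * (1 - x) ^ laterCount d t i)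
    (fun i => by fun_prop)]
  exact Finset.prod_congr rfl fun i _ => h.integral_pow i _ _

lemma evidence_pos (hτ : 2 ≤ τ) (R : AttachmentRule) (d : ℕ) (t : ℕ → ℕ) :
    0 < evidence R τ d t := by
  refine Finset.prod_pos fun i _ => ?_
  have h1 := seedSize_sub_discount_pos hτ R i
  have h2 := concentration_add_discount_pos R (x := i + 1) (by positivity)
  exact div_pos (beta_pos (by positivity) (by positivity)) (beta_pos h1 h2)

/-- The predictive probability that branch `i` grows: the product of ratios of beta functions
telescopes. -/
lemma evidence_add_single (hτ : 2 ≤ τ) {d i : ℕ} (hi : i < d) (t : ℕ → ℕ) :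
    evidence R τ d (t + Pi.single i 1) = evidence R τ d t *
      (((t i + seedSize τ i : ℕ) - discount R) / tailWeight R τ d t 0) := by
  have hd : 0 < d := by omega
  have htel : ((t i + seedSize τ i : ℕ) - discount R) / tailWeight R τ d t 0 =
      ((t i + seedSize τ i : ℕ) - discount R) / tailWeight R τ d t i *
      ∏ j ∈ Finset.range i, (tailWeight R τ d t (j + 1) / tailWeight R τ d t j) := by
    rw [prod_tailWeight_div hτ hi.le hd]
    have := (tailWeight_pos (R := R) (t := t) hτ hi).ne'
    field_simp
  rw [htel, ← prod_range_ite hi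
    (fun j => (((t j + seedSize τ j : ℕ) : ℝ) - discount R) / tailWeight R τ d t j), evidence,
    evidence, ← Finset.prod_mul_distrib]
  refine Finset.prod_congr rfl fun j hj => ?_
  have hjd := Finset.mem_range.1 hj
  have ha : seedSize τ j - discount R + t j = ((t j + seedSize τ j : ℕ) : ℝ) - discount R := by
    push_cast; ring
  have ha0 := size_sub_discount_pos hτ R t j
  have hb0 : 0 < tailWeight R τ d t (j + 1) := tailWeight_succ_pos j
  rw [laterCount_add_single hi, Pi.add_apply, Pi.single_apply, tailWeight_eq_add hjd]
  rcases lt_trichotomy j i with hji | hji | hji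
  · rw [if_neg hji.ne, if_pos hji, if_neg hji.ne, if_pos hji]
    push_cast
    push_cast at ha ha0
    rw [add_zero, ← add_assoc, ← tailWeight_succ_eq, ha, beta_add_one_right ha0 hb0]
    ring
  · subst hji
    rw [if_pos rfl, if_pos rfl, if_neg (lt_irrefl _), add_zero, ← tailWeight_succ_eq]
    push_cast at ha ha0 ⊢
    rw [← add_assoc, ha, beta_add_one_left ha0 hb0]
    ring
  · rw [if_neg hji.ne', if_neg (by omega), if_neg hji.ne', if_neg (by omega)]
    simp

/-- The predictive probability of a new branch. -/
lemma evidence_succ (hτ : 2 ≤ τ) {d : ℕ} (hd : 0 < d) {t : ℕ → ℕ} (ht : t d = 0) :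
    evidence R τ (d + 1) t = evidence R τ d t *
      ((concentration R + discount R * d) / tailWeight R τ d t 0) := by
  rw [← tailWeight_self (R := R) (τ := τ) (t := t), ← prod_tailWeight_div hτ le_rfl hd, evidence,
    Finset.prod_range_succ, evidence, ← Finset.prod_mul_distrib]
  have hlast : laterCount (d + 1) t d = 0 := by simp [laterCount]
  rw [ht, hlast, Nat.cast_zero, add_zero, add_zero, div_self
    (beta_pos (seedSize_sub_discount_pos hτ R d)
      (concentration_add_discount_pos R (by positivity))).ne', mul_one]
  refine Finset.prod_congr rfl fun j hj => ?_
  have hjd := Finset.mem_range.1 hj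
  have ha : seedSize τ j - discount R + t j = ((t j + seedSize τ j : ℕ) : ℝ) - discount R := by
    push_cast; ring
  have ha0 := size_sub_discount_pos hτ R t j
  have hb0 : 0 < tailWeight R τ d t (j + 1) := tailWeight_succ_pos j
  rw [laterCount_succ ht hjd, tailWeight_eq_add hjd, Nat.cast_add, Nat.cast_one, ← add_assoc,
    ← tailWeight_succ_eq, ha, beta_add_one_right ha0 hb0]
  ring

/-- The posterior expectation of `F`, given that `d` branches have appeared and branch `i`
has grown by `t i` vertices. -/
noncomputable def posterior (R : AttachmentRule) (τ : ℕ) (Q : Measure Ω) (φ : ℕ → Ω → ℝ)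
    (F : Ω → ℝ) (d : ℕ) (t : ℕ → ℕ) : ℝ :=
  (∫ ω, F ω * likelihood d t (φ · ω) ∂Q) / evidence R τ d t

lemma integrable_mul_likelihood (h : IsStickBreaking R τ Q φ) {F : Ω → ℝ} (hF : Integrable F Q)
    (d : ℕ) (t : ℕ → ℕ) : Integrable (fun ω => F ω * likelihood d t (φ · ω)) Q := by
  refine hF.mul_bdd (c := 1) (h.measurable_likelihood d t).aestronglyMeasurable
    (ae_of_all _ fun ω => ?_)
  rw [Real.norm_eq_abs, abs_of_nonneg (likelihood_nonneg (h.mem ω) d t)]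
  exact likelihood_le_one (h.mem ω) d t

lemma integrable_mul_stickPiece (h : IsStickBreaking R τ Q φ) {F : Ω → ℝ} (hF : Integrable F Q)
    (i : ℕ) : Integrable (fun ω => F ω * stickPiece (φ · ω) i) Q := by
  refine hF.mul_bdd (c := 1) (h.measurable_stickPiece i).aestronglyMeasurable
    (ae_of_all _ fun ω => ?_)
  rw [Real.norm_eq_abs, abs_of_nonneg (stickPiece_nonneg (h.mem ω) i)]
  exact (stickPiece_le_rest (h.mem ω) i).trans (stickRest_le_one (h.mem ω) i)

lemma integrable_stickRest (h : IsStickBreaking R τ Q φ) (i : ℕ) :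
    Integrable (fun ω => stickRest (φ · ω) i) Q := by
  have := h.isProbabilityMeasure
  refine Integrable.of_bound (h.measurable_stickRest i).aestronglyMeasurable 1
    (ae_of_all _ fun ω => ?_)
  rw [Real.norm_eq_abs, abs_of_nonneg (stickRest_nonneg (h.mem ω) i)]
  exact stickRest_le_one (h.mem ω) i

/-- Weighting by a piece of the stick amounts to observing one more growth of that branch. -/
lemma posterior_mul_stickPiece (h : IsStickBreaking R τ Q φ) (F : Ω → ℝ) {d i : ℕ} (hi : i < d)
    (t : ℕ → ℕ) :
    posterior R τ Q φ (fun ω => F ω * stickPiece (φ · ω) i) d t =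
      ((t i + seedSize τ i : ℕ) - discount R) / tailWeight R τ d t 0 *
        posterior R τ Q φ F d (t + Pi.single i 1) := by
  have h1 := (evidence_pos h.two_le R d t).ne'
  have h2 := (size_sub_discount_pos h.two_le R t i).ne'
  have h3 := (tailWeight_pos (R := R) (t := t) h.two_le (show 0 < d by omega)).ne'
  rw [posterior, posterior, evidence_add_single h.two_le hi]
  simp_rw [likelihood_add_single hi, mul_comm (likelihood d t _) (stickPiece _ i), ← mul_assoc]
  field_simp

/-- Weighting by the rest of the stick amounts to observing a new branch. -/
lemma posterior_mul_stickRest (h : IsStickBreaking R τ Q φ) (F : Ω → ℝ) {d : ℕ} (hd : 0 < d)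
    {t : ℕ → ℕ} (ht : t d = 0) :
    posterior R τ Q φ (fun ω => F ω * stickRest (φ · ω) d) d t =
      (concentration R + discount R * d) / tailWeight R τ d t 0 *
        posterior R τ Q φ F (d + 1) t := by
  have h1 := (evidence_pos h.two_le R d t).ne'
  have h2 := (concentration_add_discount_pos R (x := d) (by positivity)).ne'
  have h3 := (tailWeight_pos (R := R) (t := t) h.two_le hd).ne'
  rw [posterior, posterior, evidence_succ h.two_le hd ht]
  simp_rw [likelihood_succ ht, mul_comm (likelihood d t _) (stickRest _ d), ← mul_assoc]
  field_simp

lemma posterior_add (h : IsStickBreaking R τ Q φ) {F F' : Ω → ℝ} (hF : Integrable F Q)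
    (hF' : Integrable F' Q) (d : ℕ) (t : ℕ → ℕ) :
    posterior R τ Q φ (fun ω => F ω + F' ω) d t =
      posterior R τ Q φ F d t + posterior R τ Q φ F' d t := by
  simp only [posterior, add_mul]
  rw [integral_add (h.integrable_mul_likelihood hF d t) (h.integrable_mul_likelihood hF' d t),
    add_div]

lemma posterior_sum (h : IsStickBreaking R τ Q φ) {ι : Type*} (s : Finset ι) {F : ι → Ω → ℝ}
    (hF : ∀ i, Integrable (F i) Q) (d : ℕ) (t : ℕ → ℕ) :
    posterior R τ Q φ (fun ω => ∑ i ∈ s, F i ω) d t =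
      ∑ i ∈ s, posterior R τ Q φ (F i) d t := by
  simp only [posterior, Finset.sum_mul]
  rw [integral_finsetSum _ fun i _ => h.integrable_mul_likelihood (hF i) d t, Finset.sum_div]

lemma posterior_const (h : IsStickBreaking R τ Q φ) (a : ℝ) (d : ℕ) (t : ℕ → ℕ) :
    posterior R τ Q φ (fun _ => a) d t = a := by
  rw [posterior, integral_const_mul, h.integral_likelihood,
    mul_div_cancel_right₀ _ (evidence_pos h.two_le R d t).ne']

lemma posterior_const_mul (a : ℝ) (F : Ω → ℝ) (d : ℕ) (t : ℕ → ℕ) :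
    posterior R τ Q φ (fun ω => a * F ω) d t = a * posterior R τ Q φ F d t := by
  simp only [posterior, mul_assoc]
  rw [integral_const_mul, mul_div_assoc]

lemma posterior_mono (h : IsStickBreaking R τ Q φ) {F F' : Ω → ℝ} (hF : Integrable F Q)
    (hF' : Integrable F' Q) (hle : ∀ ω, F ω ≤ F' ω) (d : ℕ) (t : ℕ → ℕ) :
    posterior R τ Q φ F d t ≤ posterior R τ Q φ F' d t := by
  have := evidence_pos h.two_le R d t
  unfold posterior
  gcongr
  · exact h.integrable_mul_likelihood hF d t
  · exact h.integrable_mul_likelihood hF' d t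
  · intro ω
    exact mul_le_mul_of_nonneg_right (hle ω) (likelihood_nonneg (h.mem ω) d t)

/-- The posterior expectation is harmonic for the Chinese restaurant process of the branches. -/
lemma posterior_harmonic (h : IsStickBreaking R τ Q φ) {F : Ω → ℝ} (hF : Integrable F Q) {d : ℕ}
    (hd : 0 < d) {t : ℕ → ℕ} (ht : t d = 0) :
    posterior R τ Q φ F d t =
      (concentration R + discount R * d) / tailWeight R τ d t 0 * posterior R τ Q φ F (d + 1) t +
      ∑ i ∈ Finset.range d, ((t i + seedSize τ i : ℕ) - discount R) / tailWeight R τ d t 0 *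
        posterior R τ Q φ F d (t + Pi.single i 1) := by
  have hFR : Integrable (fun ω => F ω * stickRest (φ · ω) d) Q := by
    refine hF.mul_bdd (c := 1) (h.measurable_stickRest d).aestronglyMeasurable
      (ae_of_all _ fun ω => ?_)
    rw [Real.norm_eq_abs, abs_of_nonneg (stickRest_nonneg (h.mem ω) d)]
    exact stickRest_le_one (h.mem ω) d
  rw [← h.posterior_mul_stickRest F hd ht,
    ← Finset.sum_congr rfl fun i hi => h.posterior_mul_stickPiece F (Finset.mem_range.1 hi) t,
    ← h.posterior_sum _ (fun i => h.integrable_mul_stickPiece hF i),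
    ← h.posterior_add hFR (integrable_finsetSum _ fun i _ => h.integrable_mul_stickPiece hF i)]
  congr 1
  funext ω
  rw [← Finset.mul_sum, ← mul_add, add_comm (stickRest _ _), sum_stickPiece, mul_one]

/-- Under the posterior law, the variance of the size of a piece is of the order of the inverse
total weight. -/
lemma posterior_sq_sub_le (h : IsStickBreaking R τ Q φ) {d i : ℕ} (hi : i < d) (t : ℕ → ℕ) :
    posterior R τ Q φ (fun ω => (stickPiece (φ · ω) i -
        ((t i + seedSize τ i : ℕ) - discount R) / tailWeight R τ d t 0) ^ 2) d t ≤
      ((t i + seedSize τ i : ℕ) - discount R) / tailWeight R τ d t 0 / tailWeight R τ d t 0 := by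
  have := h.isProbabilityMeasure
  set W := tailWeight R τ d t 0 with hW
  have hW0 : 0 < W := tailWeight_pos h.two_le (show 0 < d by omega)
  set a : ℝ := (t i + seedSize τ i : ℕ) - discount R with ha
  have ha0 : 0 < a := size_sub_discount_pos h.two_le R t i
  -- the first two moments are the probabilities of observing one or two growths of branch `i`
  have h1 := h.posterior_mul_stickPiece (fun _ => 1) hi t
  have h2 := h.posterior_mul_stickPiece (fun ω => 1 * stickPiece (φ · ω) i) hi t
  rw [h.posterior_mul_stickPiece (fun _ => 1) hi (t + Pi.single i 1),
    tailWeight_add_single hi] at h2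
  simp only [h.posterior_const, one_mul, mul_one, ← ha, ← hW, Pi.add_apply, Pi.single_eq_same]
    at h1 h2
  have h3 : ((t i + 1 + seedSize τ i : ℕ) : ℝ) - discount R = a + 1 := by
    rw [ha]; push_cast; ring
  rw [h3] at h2
  have i1 : Integrable (fun ω => stickPiece (φ · ω) i) Q := by
    simpa using h.integrable_mul_stickPiece (integrable_const (1 : ℝ)) i
  have i2 : Integrable (fun ω => stickPiece (φ · ω) i * stickPiece (φ · ω) i) Q :=
    h.integrable_mul_stickPiece i1 i
  have h4 : posterior R τ Q φ (fun ω => (stickPiece (φ · ω) i - a / W) ^ 2) d t =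
      a / W * ((a + 1) / (W + 1)) + (-(2 * (a / W)) * (a / W) + (a / W) ^ 2) := by
    rw [← h2, ← h.posterior_const ((a / W) ^ 2) d t]
    rw [← show posterior R τ Q φ (fun ω => -(2 * (a / W)) * stickPiece (φ · ω) i) d t =
        -(2 * (a / W)) * (a / W) by rw [posterior_const_mul, h1],
      ← h.posterior_add (i1.const_mul _) (integrable_const _),
      ← h.posterior_add (F' := fun ω => -(2 * (a / W)) * stickPiece (φ · ω) i + (a / W) ^ 2)
        i2 ((i1.const_mul _).add (integrable_const _))]
    congr 1
    funext ω
    ring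
  rw [h4]
  have h5 : a / W / W - (a / W * ((a + 1) / (W + 1)) + (-(2 * (a / W)) * (a / W) + (a / W) ^ 2)) =
      a / W * (1 + a) / (W * (W + 1)) := by
    field_simp; ring
  have h6 : 0 ≤ a / W * (1 + a) / (W * (W + 1)) := by positivity
  linarith

/-- A Lipschitz function of the largest piece has nearly the posterior expectation obtained
by substituting the largest share among the branches for the largest piece. -/
lemma abs_posterior_sub_le (h : IsStickBreaking R τ Q φ) {f : ℝ → ℝ} {K : NNReal}
    (hf : LipschitzWith K f) {d : ℕ} (hd : 0 < d) {t : ℕ → ℕ} (ht : t d = 0) {M : ℝ}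
    (hM : ∀ i < d, ((t i + seedSize τ i : ℕ) - discount R) / tailWeight R τ d t 0 ≤ M)
    (hMs : ∃ j < d, M = ((t j + seedSize τ j : ℕ) - discount R) / tailWeight R τ d t 0)
    (hint : Integrable (fun ω => f (⨆ l, stickPiece (φ · ω) l)) Q) {ε : ℝ} (hε : 0 < ε) :
    |posterior R τ Q φ (fun ω => f (⨆ l, stickPiece (φ · ω) l)) d t - f M| ≤
      K * (ε + 1 / (ε * tailWeight R τ d t 0) +
        (concentration R + discount R * d) / tailWeight R τ d t 0) := by
  have := h.isProbabilityMeasure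
  set W := tailWeight R τ d t 0 with hW
  have hW0 : 0 < W := tailWeight_pos h.two_le hd
  set s : ℕ → ℝ := fun i => ((t i + seedSize τ i : ℕ) - discount R) / W with hs
  have hs0 : ∀ i, 0 ≤ s i := fun i => (div_pos (size_sub_discount_pos h.two_le R t i) hW0).le
  have hM0 : 0 ≤ M := (hs0 0).trans (hM 0 hd)
  have isq : ∀ i, Integrable (fun ω => (stickPiece (φ · ω) i - s i) ^ 2) Q := by
    intro i
    have i1 : Integrable (fun ω => stickPiece (φ · ω) i) Q := by
      simpa using h.integrable_mul_stickPiece (integrable_const (1 : ℝ)) i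
    have i2 : Integrable (fun ω => stickPiece (φ · ω) i * stickPiece (φ · ω) i) Q :=
      h.integrable_mul_stickPiece i1 i
    refine ((i2.add (i1.const_mul (-(2 * s i)))).add (integrable_const (s i ^ 2))).congr
      (ae_of_all _ fun ω => ?_)
    simp only [Pi.add_apply]
    ring
  have isum := integrable_finsetSum (Finset.range d) fun i _ => isq i
  have irest := h.integrable_stickRest d
  let B : Ω → ℝ := fun ω => K * ε + ((K / ε) * (∑ i ∈ Finset.range d,
    (stickPiece (φ · ω) i - s i) ^ 2) + K * stickRest (φ · ω) d)
  have iB1 : Integrable (fun ω => (K / ε) * (∑ i ∈ Finset.range d,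
    (stickPiece (φ · ω) i - s i) ^ 2)) Q := isum.const_mul _
  have iB2 : Integrable (fun ω => K * stickRest (φ · ω) d) Q := irest.const_mul _
  have iB : Integrable B Q := (integrable_const _).add (iB1.add iB2)
  have hB : ∀ ω, |f (⨆ l, stickPiece (φ · ω) l) - f M| ≤ B ω := by
    intro ω
    have h1 := hf.dist_le_mul (⨆ l, stickPiece (φ · ω) l) M
    rw [Real.dist_eq, Real.dist_eq] at h1
    have h2 := mul_le_mul_of_nonneg_left
      (abs_iSup_stickPiece_sub_le (h.mem ω) hM0 hM hMs hε) K.coe_nonneg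
    refine (h1.trans h2).trans (le_of_eq ?_)
    simp only [B]; ring
  have hpost : posterior R τ Q φ B d t ≤ K * (ε + 1 / (ε * W) +
      (concentration R + discount R * d) / W) := by
    have hrest : posterior R τ Q φ (fun ω => stickRest (φ · ω) d) d t =
        (concentration R + discount R * d) / W := by
      simpa [h.posterior_const] using h.posterior_mul_stickRest (fun _ => 1) hd ht
    have hsum : posterior R τ Q φ (fun ω => ∑ i ∈ Finset.range d,
        (stickPiece (φ · ω) i - s i) ^ 2) d t ≤ 1 / W := by
      rw [h.posterior_sum _ isq]
      calc _ ≤ ∑ i ∈ Finset.range d, s i / W := Finset.sum_le_sum fun i hi =>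
            h.posterior_sq_sub_le (Finset.mem_range.1 hi) t
        _ ≤ 1 / W := by
          rw [← Finset.sum_div]
          gcongr
          -- the predictive probabilities of all branches and of a new one add up to `1`
          have h1 := h.posterior_harmonic (integrable_const (1 : ℝ)) hd ht
          simp only [h.posterior_const, mul_one] at h1
          have h2 : 0 ≤ (concentration R + discount R * d) / W :=
            div_nonneg (concentration_add_discount_pos R (by positivity)).le hW0.le
          simp only [hs, hW] at h2 ⊢
          linarith
    rw [h.posterior_add (F' := fun ω => (K / ε) * (∑ i ∈ Finset.range d,
        (stickPiece (φ · ω) i - s i) ^ 2) + K * stickRest (φ · ω) d)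
        (integrable_const _) (iB1.add iB2), h.posterior_add iB1 iB2,
      h.posterior_const, posterior_const_mul, posterior_const_mul, hrest]
    have h1 := mul_le_mul_of_nonneg_left hsum (div_nonneg K.coe_nonneg hε.le)
    have h2 : (K : ℝ) / ε * (1 / W) = K * (1 / (ε * W)) := by field_simp
    rw [mul_add, mul_add]
    linarith
  refine le_trans ?_ hpost
  have hsub : posterior R τ Q φ (fun ω => f (⨆ l, stickPiece (φ · ω) l)) d t - f M =
      posterior R τ Q φ (fun ω => f (⨆ l, stickPiece (φ · ω) l) + -f M) d t := by
    rw [h.posterior_add hint (integrable_const _), h.posterior_const, sub_eq_add_neg]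
  rw [hsub, abs_le]
  have iF : Integrable (fun ω => f (⨆ l, stickPiece (φ · ω) l) + -f M) Q :=
    hint.add (integrable_const _)
  constructor
  · have : -posterior R τ Q φ B d t = posterior R τ Q φ (fun ω => -1 * B ω) d t := by
      rw [posterior_const_mul]; ring
    rw [this]
    refine h.posterior_mono (iB.const_mul _) iF (fun ω => ?_) d t
    have := (abs_le.1 (hB ω)).1
    linarith
  · refine h.posterior_mono iF iB (fun ω => ?_) d t
    have := (abs_le.1 (hB ω)).2
    linarith

/-- On the arrival of the vertex nothing has been observed yet. -/
lemma posterior_start (F : Ω → ℝ) (hτ : 2 ≤ τ) : posterior R τ Q φ F 1 0 = ∫ ω, F ω ∂Q := by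
  have h1 := (beta_pos (seedSize_sub_discount_pos hτ R 0)
    (concentration_add_discount_pos R (x := 0 + 1) (by positivity))).ne'
  simp [posterior, likelihood, evidence, laterCount] at h1 ⊢
  rw [div_self h1, div_one]

/-! ### The stick is used up -/

lemma integral_stickRest_le (h : IsStickBreaking R τ Q φ) (l : ℕ) :
    ∫ ω, stickRest (φ · ω) l ∂Q ≤ 2 / (l + 1) := by
  simp only [stickRest]
  rw [h.integral_prod l (fun _ x => 1 - x) (fun _ => by fun_prop)]
  -- the bounds telescope; they are equalities for `i ≥ 1` under preferential attachment
  have key : ∀ i : ℕ, ∫ ω, (1 - φ i ω) ∂Q ≤ if i = 0 then 1 else ((i : ℝ) + 1) / (i + 2) := by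
    intro i
    have ha := seedSize_sub_discount_pos h.two_le R i
    have hb := concentration_add_discount_pos R (x := i + 1) (by positivity)
    have h1 := h.integral_pow i 0 1
    simp only [pow_zero, pow_one, one_mul, Nat.cast_zero, add_zero, Nat.cast_one] at h1
    rw [beta_add_one_right ha hb, mul_div_cancel_left₀ _ (beta_pos ha hb).ne'] at h1
    rw [h1]
    split_ifs with hi
    · rw [div_le_one (by positivity)]; linarith
    · simp only [seedSize, hi, if_false, Nat.cast_one]
      cases R
      · simp only [concentration, discount]
        rw [div_le_div_iff₀ (by norm_num) (by positivity)]
        have : (0 : ℝ) ≤ i := by positivity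
        linarith
      · simp only [concentration, discount]
        refine le_of_eq ?_
        have : (1 : ℝ) - 1 / 2 + (0 + 1 / 2 * (i + 1)) ≠ 0 := by positivity
        field_simp
        ring
  have hnn : ∀ i : ℕ, 0 ≤ ∫ ω, (1 - φ i ω) ∂Q := fun i =>
    integral_nonneg fun ω => sub_nonneg.2 (h.mem ω i).2
  induction l with
  | zero => simp
  | succ l ih =>
    rw [Finset.prod_range_succ]
    rcases Nat.eq_zero_or_pos l with rfl | hl
    · have := key 0
      simp at this ⊢
      linarith
    · have h1 := key l
      rw [if_neg hl.ne'] at h1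
      refine (mul_le_mul ih h1 (hnn l) (by positivity)).trans (le_of_eq ?_)
      push_cast
      field_simp
      ring

lemma ae_tendsto_stickRest (h : IsStickBreaking R τ Q φ) :
    ∀ᵐ ω ∂Q, Tendsto (stickRest (φ · ω)) atTop (𝓝 0) := by
  have := h.isProbabilityMeasure
  have hbdd : ∀ ω, BddBelow (Set.range (stickRest (φ · ω))) := fun ω =>
    ⟨0, by rintro _ ⟨l, rfl⟩; exact stickRest_nonneg (h.mem ω) l⟩
  have hlim : ∀ ω, Tendsto (stickRest (φ · ω)) atTop (𝓝 (⨅ l, stickRest (φ · ω) l)) := fun ω =>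
    tendsto_atTop_ciInf (stickRest_antitone (h.mem ω)) (hbdd ω)
  have hnn : ∀ ω, 0 ≤ ⨅ l, stickRest (φ · ω) l := fun ω =>
    le_ciInf fun l => stickRest_nonneg (h.mem ω) l
  have hmeas : Measurable fun ω => ⨅ l, stickRest (φ · ω) l :=
    Measurable.iInf h.measurable_stickRest
  have hint : Integrable (fun ω => ⨅ l, stickRest (φ · ω) l) Q := by
    refine Integrable.of_bound hmeas.aestronglyMeasurable 1 (ae_of_all _ fun ω => ?_)
    rw [Real.norm_eq_abs, abs_of_nonneg (hnn ω)]
    exact (ciInf_le (hbdd ω) 0).trans (stickRest_le_one (h.mem ω) 0)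
  have hle : ∀ l : ℕ, ∫ ω, ⨅ l, stickRest (φ · ω) l ∂Q ≤ 2 * (1 / ((l : ℝ) + 1)) := fun l =>
    (integral_mono hint (h.integrable_stickRest l) fun ω => ciInf_le (hbdd ω) l).trans
      ((h.integral_stickRest_le l).trans (le_of_eq (by ring)))
  have hzero : ∫ ω, ⨅ l, stickRest (φ · ω) l ∂Q = 0 := by
    refine le_antisymm ?_ (integral_nonneg hnn)
    refine ge_of_tendsto' (x := atTop) ?_ hle
    simpa using tendsto_one_div_add_atTop_nhds_zero_nat.const_mul (2 : ℝ)
  rw [integral_eq_zero_iff_of_nonneg hnn hint] at hzero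
  filter_upwards [hzero] with ω hω
  have := hlim ω
  rwa [show (⨅ l, stickRest (φ · ω) l) = 0 from hω] at this

end IsStickBreaking

/-! ### Comparison of the growing tree with the sticks -/

/-- The discounted number of branches grows more slowly than the total weight `W`: one step
multiplies its expectation by at most `1 + α / W ≤ 1 + 1 / (2 W)`. -/
lemma one_add_discount_div_mul_sqrt_le (R : AttachmentRule) {W : ℝ} (hW : 1 ≤ W) :
    (1 + discount R / W) * √(W - 1 / 2) ≤ √(W + 1 / 2) := by
  have h0 := discount_nonneg R
  have h1 : 0 ≤ 1 + discount R / W := by positivity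
  have h2 : 1 + discount R / W ≤ 1 + 1 / 2 / W := by
    gcongr; exact discount_le R
  refine (mul_le_mul_of_nonneg_right h2 (Real.sqrt_nonneg _)).trans ?_
  refine Real.le_sqrt_of_sq_le ?_
  rw [mul_pow, Real.sq_sqrt (by linarith)]
  have h3 : W + 1 / 2 - (1 + 1 / 2 / W) ^ 2 * (W - 1 / 2) = (W + 1 / 2) / (4 * W ^ 2) := by
    field_simp; ring
  have h4 : 0 ≤ (W + 1 / 2) / (4 * W ^ 2) := by positivity
  linarith

namespace IsStickBreaking

variable {Ω' : Type*} [MeasurableSpace Ω'] {R : AttachmentRule} {τ : ℕ} {Q : Measure Ω'}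
  {φ : ℕ → Ω' → ℝ}

/-- Starting from a tree with known branches, the expectation of a Lipschitz function of the
largest share after `k` steps is close to the posterior expectation of that function of the largest
piece of the stick. -/
lemma abs_expectedValue_sub_le (h : IsStickBreaking R τ Q φ) {f : ℝ → ℝ} {K : NNReal}
    (hf : LipschitzWith K f) (hint : Integrable (fun ω => f (⨆ l, stickPiece (φ · ω) l)) Q)
    {ε : ℝ} (hε : 0 < ε) (k : ℕ) {n : ℕ} {G : SimpleGraph (Fin n)} {v : Fin n} {d : ℕ}
    {c : Fin n → ℕ} {t : ℕ → ℕ} (hb : IsBranching τ G v d c t) :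
    |expectedValue R (fun m G' => f (maxShare R v m G')) k n G -
        posterior R τ Q φ (fun ω => f (⨆ l, stickPiece (φ · ω) l)) d t| ≤
      K * (ε + 1 / (ε * (totalWeight R n + k)) + (concentration R + discount R * d) *
        (√(totalWeight R n + k - 1 / 2) /
          (√(totalWeight R n - 1 / 2) * (totalWeight R n + k)))) := by
  induction k generalizing n d t with
  | zero =>
    have hW := one_le_totalWeight R hb.two_le
    have hW0 := hb.tailWeight_zero R
    have hs : 0 < √(totalWeight R n - 1 / 2) := Real.sqrt_pos.2 (by linarith)
    obtain ⟨j, hj, hsup⟩ := Finset.exists_mem_eq_sup (Finset.range d)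
      ⟨0, Finset.mem_range.2 hb.pos⟩ (fun i => t i + seedSize τ i)
    have hM : maxShare R v n G =
        ((t j + seedSize τ j : ℕ) - discount R) / tailWeight R τ d t 0 := by
      rw [maxShare_eq, hb.antiCentrality_eq, hsup, hW0]
    have := h.abs_posterior_sub_le hf hb.pos (hb.zero_of_le d le_rfl) (M := maxShare R v n G)
      (fun i hi => by
        rw [hM, hW0, ← hsup]
        gcongr
        exact Finset.le_sup (f := fun i => t i + seedSize τ i) (Finset.mem_range.2 hi))
      ⟨j, Finset.mem_range.1 hj, hM⟩ hint hε
    rw [hW0] at this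
    rw [abs_sub_comm, Nat.cast_zero, add_zero, ← div_div (√_), div_self hs.ne', mul_one_div]
    exact this
  | succ k ih =>
    set F : Ω' → ℝ := fun ω => f (⨆ l, stickPiece (φ · ω) l) with hF
    have hW := one_le_totalWeight R hb.two_le
    set W := totalWeight R n with hWdef
    have hk : (0 : ℝ) ≤ k := by positivity
    set D := concentration R + discount R * d with hD
    set r := √(W + 1 + k - 1 / 2) / (√(W + 1 - 1 / 2) * (W + 1 + k)) with hr
    have hDpos : 0 ≤ D := (concentration_add_discount_pos R (by exact_mod_cast hb.pos)).le
    let H : Fin n → ℝ := fun u => if u = v then posterior R τ Q φ F (d + 1) t else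
      posterior R τ Q φ F d (t + Pi.single (c u) 1)
    have hstep : ∀ u, |expectedValue R (fun m G' => f (maxShare R v m G')) k (n + 1) (attach G u) -
        H u| ≤ K * (ε + 1 / (ε * (W + 1 + k)) + (D + if u = v then discount R else 0) * r) := by
      intro u
      by_cases hu : u = v
      · subst hu
        have := ih hb.attach_root
        rw [totalWeight_succ] at this
        simp only [H, if_true]
        refine this.trans (le_of_eq ?_)
        rw [hD, hr]; push_cast; ring
      · have := ih (hb.attach_of_ne hu)
        rw [totalWeight_succ] at this
        simp only [H, if_neg hu, add_zero]
        exact this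
    have hharm : posterior R τ Q φ F d t = ∑ u, attachProb R G u * H u := by
      rw [hb.sum_attachProb_mul R H (fun i => posterior R τ Q φ F d (t + Pi.single i 1))
        fun u hu => by simp only [H, if_neg hu],
        h.posterior_harmonic hint hb.pos (hb.zero_of_le d le_rfl), hb.tailWeight_zero R]
      simp only [H, if_true]
    have hmean : ∑ u, attachProb R G u *
        (K * (ε + 1 / (ε * (W + 1 + k)) + (D + if u = v then discount R else 0) * r)) =
        K * (ε + 1 / (ε * (W + 1 + k)) + D * ((1 + discount R / W) * r)) := by
      have h1 : ∀ u, attachProb R G u *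
          (K * (ε + 1 / (ε * (W + 1 + k)) + (D + if u = v then discount R else 0) * r)) =
          attachProb R G u * (K * (ε + 1 / (ε * (W + 1 + k)) + D * r)) +
          if u = v then attachProb R G v * (K * discount R * r) else 0 := by
        intro u
        split_ifs with hu
        · subst hu; ring
        · ring
      rw [Finset.sum_congr rfl fun u _ => h1 u, Finset.sum_add_distrib, ← Finset.sum_mul,
        hb.isGrown.sum_attachProb hb.two_le, Finset.sum_ite_eq', if_pos (Finset.mem_univ _),
        hb.attachProb_root]
      rw [← hD, ← hWdef]
      ring
    have hrate : (1 + discount R / W) * r ≤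
        √(W + 1 + k - 1 / 2) / (√(W - 1 / 2) * (W + 1 + k)) := by
      have h1 := one_add_discount_div_mul_sqrt_le R hW
      have h2 : 0 < √(W - 1 / 2) := Real.sqrt_pos.2 (by linarith)
      have h3 : 0 < √(W + 1 / 2) := Real.sqrt_pos.2 (by linarith)
      have h4 : 0 < W + 1 + k := by linarith
      rw [hr, show W + 1 - 1 / 2 = W + 1 / 2 by ring, ← mul_div_assoc,
        div_le_div_iff₀ (by positivity) (by positivity)]
      have h5 : 0 ≤ √(W + 1 + k - 1 / 2) * (W + 1 + k) := by positivity
      have := mul_le_mul_of_nonneg_right h1 h5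
      linarith
    have hcast : W + ((k + 1 : ℕ) : ℝ) = W + 1 + k := by push_cast; ring
    rw [hcast]
    calc |expectedValue R (fun m G' => f (maxShare R v m G')) (k + 1) n G -
          posterior R τ Q φ F d t|
        = |∑ u, attachProb R G u * (expectedValue R (fun m G' => f (maxShare R v m G')) k (n + 1)
            (attach G u) - H u)| := by
          rw [hharm, expectedValue, ← Finset.sum_sub_distrib]
          simp only [mul_sub]
      _ ≤ ∑ u, attachProb R G u *
          (K * (ε + 1 / (ε * (W + 1 + k)) + (D + if u = v then discount R else 0) * r)) := by
          refine (Finset.abs_sum_le_sum_abs _ _).trans (Finset.sum_le_sum fun u _ => ?_)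
          rw [abs_mul, abs_of_nonneg (attachProb_nonneg R G u)]
          exact mul_le_mul_of_nonneg_left (hstep u) (attachProb_nonneg R G u)
      _ ≤ _ := by
          rw [hmean]
          gcongr

variable {Ω : Type*} [MeasurableSpace Ω] {P : Measure Ω} [IsProbabilityMeasure P]
  {T : (n : ℕ) → Ω → SimpleGraph (Fin n)}

/-- The share of the largest branch converges in distribution to the largest piece. -/
lemma tendsto_integral_maxShare {v : ℕ} (h : IsStickBreaking R (timestamp v) Q φ)
    (hT : IsGrowingTree R P T) {f : ℝ → ℝ} {K : NNReal} (hf : LipschitzWith K f)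
    (hint : Integrable (fun ω => f (⨆ l, stickPiece (φ · ω) l)) Q) :
    Tendsto (fun n => ∫ ω, f (maxShare R v n (T n ω)) ∂P) atTop
      (𝓝 (∫ ω, f (⨆ l, stickPiece (φ · ω) l) ∂Q)) := by
  set τ := timestamp v with hτ
  have h2 : 2 ≤ τ := two_le_timestamp v
  set W := totalWeight R τ with hWdef
  have hW : 1 ≤ W := one_le_totalWeight R h2
  set I := ∫ ω, f (⨆ l, stickPiece (φ · ω) l) ∂Q with hI
  have hs : 0 < √(W - 1 / 2) := Real.sqrt_pos.2 (by linarith)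
  have hD : 0 ≤ concentration R + discount R * (1 : ℕ) :=
    (concentration_add_discount_pos R (by norm_num)).le
  -- the choice `ε = (W + k) ^ (-1 / 2)` balances the error terms
  have hbound : ∀ k : ℕ, |∫ ω, f (maxShare R v (k + τ) (T (k + τ) ω)) ∂P - I| ≤
      K * (2 + (concentration R + discount R * (1 : ℕ)) / √(W - 1 / 2)) * (√(W + k))⁻¹ := by
    intro k
    have hk : (0 : ℝ) ≤ k := by positivity
    have hWk : 0 < W + k := by linarith
    have hsk : 0 < √(W + k) := Real.sqrt_pos.2 hWk
    rw [← hT.integral_expectedValue (fun m G' => f (maxShare R v m G')) k h2 (add_comm k τ)]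
    have hEV := hT.integrable_comp (n := τ)
      (expectedValue R (fun m G' => f (maxShare R v m G')) k τ)
    have hsub : ∫ ω, expectedValue R (fun m G' => f (maxShare R v m G')) k τ (T τ ω) ∂P - I =
        ∫ ω, (expectedValue R (fun m G' => f (maxShare R v m G')) k τ (T τ ω) - I) ∂P := by
      rw [integral_sub hEV (integrable_const _)]
      simp
    rw [hsub, ← Real.norm_eq_abs]
    have hae : ∀ᵐ ω ∂P, ‖expectedValue R (fun m G' => f (maxShare R v m G')) k τ (T τ ω) - I‖ ≤
        K * (2 + (concentration R + discount R * (1 : ℕ)) / √(W - 1 / 2)) * (√(W + k))⁻¹ := by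
      filter_upwards [hT.ae_isBranching_timestamp v] with ω hω
      have h3 := h.abs_expectedValue_sub_le hf hint (inv_pos.2 hsk) k hω
      rw [posterior_start _ h2] at h3
      refine h3.trans ?_
      rw [mul_assoc]
      refine mul_le_mul_of_nonneg_left ?_ K.coe_nonneg
      have h4 : 1 / ((√(W + k))⁻¹ * (W + k)) = (√(W + k))⁻¹ := by
        nth_rw 2 [← Real.mul_self_sqrt hWk.le]
        field_simp
      have h5 : √(W + k - 1 / 2) / (√(W - 1 / 2) * (W + k)) ≤
          (√(W - 1 / 2))⁻¹ * (√(W + k))⁻¹ := by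
        calc √(W + k - 1 / 2) / (√(W - 1 / 2) * (W + k))
            ≤ √(W + k) / (√(W - 1 / 2) * (W + k)) := by
              gcongr; linarith
          _ = (√(W - 1 / 2))⁻¹ * (√(W + k))⁻¹ := by
              nth_rw 2 [← Real.mul_self_sqrt hWk.le]
              field_simp
      have h6 := mul_le_mul_of_nonneg_left h5 hD
      rw [← hWdef, h4]
      refine (add_le_add_right h6 _).trans (le_of_eq ?_)
      ring
    simpa using norm_integral_le_of_norm_le_const hae
  have hlim : Tendsto (fun k : ℕ => K * (2 + (concentration R + discount R * (1 : ℕ)) /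
      √(W - 1 / 2)) * (√(W + k))⁻¹) atTop (𝓝 0) := by
    have h1 : Tendsto (fun k : ℕ => W + (k : ℝ)) atTop atTop :=
      tendsto_atTop_add_const_left _ _ tendsto_natCast_atTop_atTop
    simpa using (tendsto_inv_atTop_zero.comp (Real.tendsto_sqrt_atTop.comp h1)).const_mul
      (K * (2 + (concentration R + discount R * (1 : ℕ)) / √(W - 1 / 2)))
  refine (tendsto_add_atTop_iff_nat τ).1 ?_
  rw [tendsto_iff_dist_tendsto_zero]
  exact squeeze_zero (fun _ => dist_nonneg) (fun k => by rw [Real.dist_eq]; exact hbound k) hlim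

/-- The almost sure limit of the largest share has the law of the largest piece. -/
lemma map_eq_of_tendsto_maxShare {v : ℕ} (h : IsStickBreaking R (timestamp v) Q φ)
    (hT : IsGrowingTree R P T) {Ψ : Ω → ℝ} (hΨ : Measurable Ψ)
    (hlim : ∀ᵐ ω ∂P, Tendsto (fun n => maxShare R v n (T n ω)) atTop (𝓝 (Ψ ω))) :
    P.map Ψ = Q.map fun ω => ⨆ l, stickPiece (φ · ω) l := by
  have := h.isProbabilityMeasure
  let μ : ProbabilityMeasure ℝ := ⟨P.map Ψ, Measure.isProbabilityMeasure_map hΨ.aemeasurable⟩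
  let ν : ProbabilityMeasure ℝ := ⟨Q.map fun ω => ⨆ l, stickPiece (φ · ω) l,
    Measure.isProbabilityMeasure_map h.measurable_iSup_stickPiece.aemeasurable⟩
  suffices hμν : μ = ν from congrArg Subtype.val hμν
  refine (tendsto_const_nhds_iff (l := (atTop : Filter ℕ))).1 ?_
  rw [tendsto_iff_forall_lipschitz_integral_tendsto]
  rintro f ⟨C, hC⟩ ⟨K, hK⟩
  have hfm : StronglyMeasurable f := hK.continuous.stronglyMeasurable
  have hbd : ∀ x, ‖f x‖ ≤ |f 0| + C := by
    intro x
    have h1 := (abs_sub_abs_le_abs_sub (f x) (f 0)).trans (hC x 0)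
    rw [Real.norm_eq_abs]; linarith
  have h1 : ∫ x, f x ∂(μ : Measure ℝ) = ∫ ω, f (Ψ ω) ∂P :=
    integral_map hΨ.aemeasurable hfm.aestronglyMeasurable
  have h2 : ∫ x, f x ∂(ν : Measure ℝ) = ∫ ω, f (⨆ l, stickPiece (φ · ω) l) ∂Q :=
    integral_map h.measurable_iSup_stickPiece.aemeasurable hfm.aestronglyMeasurable
  have h3 : Integrable (fun ω => f (⨆ l, stickPiece (φ · ω) l)) Q :=
    Integrable.of_bound (hfm.measurable.comp h.measurable_iSup_stickPiece).aestronglyMeasurable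
      _ (ae_of_all _ fun ω => hbd _)
  have h4 : Tendsto (fun n => ∫ ω, f (maxShare R v n (T n ω)) ∂P) atTop
      (𝓝 (∫ ω, f (Ψ ω) ∂P)) := by
    refine tendsto_integral_of_dominated_convergence (fun _ => |f 0| + C)
      (fun n => (hT.measurable_comp fun G => f (maxShare R v n G)).aestronglyMeasurable)
      (integrable_const _) (fun n => ae_of_all _ fun ω => hbd _) ?_
    filter_upwards [hlim] with ω hω
    exact (hK.continuous.tendsto _).comp hω
  rw [h1, h2, tendsto_nhds_unique h4 (h.tendsto_integral_maxShare hT hK h3)]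
  exact tendsto_const_nhds

/-- Random variables with the given laws agree almost surely with normalized ones. -/
lemma exists_ae_eq [IsProbabilityMeasure Q] (hτ : 2 ≤ τ) (hφ : iIndepFun φ Q)
    (hlaw : ∀ k, HasLaw (φ k) (stickLaw R τ k) Q) :
    ∃ φ' : ℕ → Ω' → ℝ, IsStickBreaking R τ Q φ' ∧ ∀ᵐ ω ∂Q, ∀ k, φ k ω = φ' k ω := by
  let φ' : ℕ → Ω' → ℝ := fun k ω => max 0 (min 1 ((hlaw k).aemeasurable.mk (φ k) ω))
  have hae : ∀ k, φ k =ᵐ[Q] φ' k := by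
    intro k
    have h1 : ∀ᵐ ω ∂Q, φ k ω ∈ Set.Icc (0 : ℝ) 1 := by
      refine ae_of_ae_map (hlaw k).aemeasurable ?_
      rw [(hlaw k).map_eq, stickLaw_eq R hτ]
      exact ae_betaMeasure_mem_Icc _ _
    filter_upwards [h1, (hlaw k).aemeasurable.ae_eq_mk] with ω hω he
    simp only [φ', ← he]
    rw [min_eq_right hω.2, max_eq_right hω.1]
  refine ⟨φ', ⟨hτ, fun k => ?_, fun ω k => ?_, hφ.congr hae, fun k => ?_⟩, ae_all_iff.2 hae⟩
  · exact measurable_const.max (measurable_const.min (hlaw k).aemeasurable.measurable_mk)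
  · exact ⟨le_max_left _ _, max_le zero_le_one (min_le_left _ _)⟩
  · rw [← Measure.map_congr (hae k), (hlaw k).map_eq]

end IsStickBreaking

end RandomTree

theorem mainTheorem9 {Ω : Type*} [MeasurableSpace Ω] (P : Measure Ω) [IsProbabilityMeasure P]
    (R : RandomTree.AttachmentRule) (T : (n : ℕ) → Ω → SimpleGraph (Fin n))
    (hT : RandomTree.IsGrowingTree R P T) (v : ℕ) :
    ∃ Ψ : Ω → ℝ, Measurable Ψ ∧
      (∀ᵐ ω ∂P, Tendsto (fun n => RandomTree.normalizedAntiCentrality (T n ω) v) atTop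
        (𝓝 (Ψ ω))) ∧
      ∀ (Ω' : Type*) [MeasurableSpace Ω'] (Q : Measure Ω') [IsProbabilityMeasure Q]
        (φ : ℕ → Ω' → ℝ),
        iIndepFun φ Q →
        (∀ k, HasLaw (φ k) (RandomTree.stickLaw R (RandomTree.timestamp v) k) Q) →
        (∀ᵐ ω' ∂Q, IsGreatest (Set.range fun l => RandomTree.stick φ l ω')
          (⨆ l, RandomTree.stick φ l ω')) ∧
        IdentDistrib Ψ (fun ω' => ⨆ l, RandomTree.stick φ l ω') P Q := by
  obtain ⟨Ψ, hΨ, hlim⟩ := hT.exists_tendsto_maxShare v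
  refine ⟨Ψ, hΨ, ?_, ?_⟩
  · filter_upwards [hlim] with ω hω
    exact RandomTree.tendsto_normalizedAntiCentrality v hω
  · intro Ω' _ Q _ φ hφ hlaw
    obtain ⟨φ', h, hae⟩ := RandomTree.IsStickBreaking.exists_ae_eq
      (RandomTree.two_le_timestamp v) hφ hlaw
    have hstick : ∀ᵐ ω ∂Q, (fun l => RandomTree.stick φ l ω) =
        RandomTree.stickPiece (φ' · ω) := by
      filter_upwards [hae] with ω hω
      funext l
      simp only [RandomTree.stick, RandomTree.stickPiece, RandomTree.stickRest, hω]
    have hsup : (fun ω => ⨆ l, RandomTree.stick φ l ω) =ᵐ[Q]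
        fun ω => ⨆ l, RandomTree.stickPiece (φ' · ω) l := by
      filter_upwards [hstick] with ω hω
      exact congrArg iSup hω
    refine ⟨?_, hΨ.aemeasurable, h.measurable_iSup_stickPiece.aemeasurable.congr hsup.symm, ?_⟩
    · filter_upwards [hstick, h.ae_tendsto_stickRest] with ω hω h0
      have := RandomTree.isGreatest_iSup_stickPiece (h.mem ω) h0
      rwa [← hω] at this
    · rw [h.map_eq_of_tendsto_maxShare hT hΨ hlim, Measure.map_congr hsup]
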